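/- **Setting.** Let $f:\mathbb R^n\to\mathbb R$ be differentiable with $f(z)\to\infty$ and $\|\nabla f(z)\|\to\infty$ as $\|z\|\to\infty$. Let $A_{eq}(z)\in\mathbb R^{m\times n}$, $A_{ineq}(z)\in\mathbb R^{p\times n}$ be matrix functions, $d_{eq}\in\mathbb R^m$, $d_{ineq}\in\mathbb R^p$, and $g_{eq}=A_{eq}\nabla f+d_{eq}$, $g_{ineq}=A_{ineq}\nabla f+d_{ineq}$, $\mathcal G_{ineq}=\{z: g_{ineq}(z)\le 0\}$. Put $\mathcal I(z)=\{i: g_{ineq,i}(z)=0\}$ and $\mathcal S=\{s\subseteq\{1,\dots,p\}: \exists z\in\mathbb R^n,\ s\subseteq\mathcal I(z)\}$. For $\mathcal A\in\mathcal S$ let $g_{\mathcal A},A_{\mathcal A},d_{\mathcal A}$ consist of all rows of $g_{eq},A_{eq},d_{eq}$ followed by the rows of $g_{ineq},A_{ineq},d_{ineq}$ with index in $\mathcal A$, and let $B_{\mathcal A}(z)=\frac{\partial g_{\mathcal A}}{\partial z}(z)A_{\mathcal A}^\top(z)$. Let $G_{\mathcal A}^\perp(z)\in\mathbb R^{(n-m-|\mathcal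 A|)\times n}$ have full row rank and satisfy $G_{\mathcal A}^\perp\frac{\partial g_{\mathcal A}}{\partial z}^\top=0$ on $\mathcal G_{ineq}$. Assume that $\nabla f$, $A_{eq}$, $A_{ineq}$, $G^\perp_{\mathcal A}$ are locally Lipschitz, and that $g_{eq},g_{ineq}$ are differentiable with locally Lipschitz Jacobians. Assume that for every $\mathcal A\in\mathcal S$ there are constants $\beta^1_{\mathcal A},\beta^2_{\mathcal A}>0$ such that for all $z\in\mathcal G_{ineq}$ the matrix $B_{\mathcal A}(z)$ is invertible and $$\tfrac12[B_{\mathcal A}(z)+B_{\mathcal A}^\top(z)]\ \ge\ \tfrac12\beta^1_{\mathcal A}B_{\mathcal A}(z)B_{\mathcal A}^\top(z)\ \ge\ \beta^2_{\mathcal A}I .$$ With $\kappa_1,\kappa_2,\delta T>0$, let $$h_{\mathcal A}(z)=-\big[\kappa_1A_{\mathcal A}^\top B_{\mathcal A}^{-1}A_{\mathcal A}+\kappa_2G_{\mathcal A}^{\perp\top}G_{\mathcal A}^{\perp}\big]\nabla f(z)-\kappa_1A_{\mathcal A}^\top B_{\mathcal A}^{-1}d_{\mathcal A}.$$ **Switched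 system.** A solution on $[0,L)$, $L\le\infty$, consists of $z$ with $z(t)=z(0)+\int_0^th_{\sigma(\tau)}(z(\tau))\,d\tau$ (integrand integrable), an active set $\sigma$ and a time of last removal $T_s$, where $(\sigma,T_s)$ is piecewise constant and left-continuous, $\sigma(0)=\mathcal I(z(0))$, $T_s(0)$ is given, and the right limits $(\sigma(t^+),T_s(t^+))$ are obtained as follows. First all $i\in\mathcal I(z(t))\setminus\sigma(t)$ with $\frac{\partial g_{ineq,i}}{\partial z}(z(t))h_{\sigma(t)}(z(t))\ge0$ are added to $\sigma$. Then the conditions of the law are tested immediately after $t$: if $(\sigma,T_s)$ is the current mode and $y$ is the solution of $\dot y=h_\sigma(y)$, $y(t)=z(t)$, then (a) all $i\in\mathcal I(z(t))\setminus\sigma$ with $\frac{\partial g_{ineq,i}}{\partial z}(y(s))h_{\sigma}(y(s))\ge0$ for times $s>t$ arbitrarily close to $t$ are added to $\sigma$; (b) if there are none, then the smallest $i\in\sigma$ for which $\frac{\partial g_{ineq,i}}{\partial z}(y(s))h_{\sigma\setminus\{i\}}(y(s))<0$ and $s>T_s+\delta T$ for times $s>t$ arbitrarily close to $t$ is removed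 from $\sigma$ and $T_s$ is set to $t$. This is repeated until neither (a) nor (b) applies. A set $W\subseteq\mathbb R^n$ is called positively invariant if every solution with $z(0)\in\mathcal G_{ineq}$, on any interval $[0,L)$, that satisfies $z(s)\in W$ also satisfies $z(t)\in W$ for all $t\ge s$ in $[0,L)$. **Claim.** 1. Let $\phi_{\mathcal A}>0$, $\mathcal A\in\mathcal S$, be constants with $A_{\mathcal A}^\top A_{\mathcal A}+G_{\mathcal A}^{\perp\top}G_{\mathcal A}^{\perp}>\phi_{\mathcal A}I$ on $\mathcal G_{ineq}$; let $\underline\phi,\underline{\beta_1},\underline{\beta_2}$ be the minima over $\mathcal A\in\mathcal S$ of $\phi_{\mathcal A},\beta^1_{\mathcal A},\beta^2_{\mathcal A}$. Every sublevel set $\{f\le c\}$ that contains $$\mathcal F=\Big\{z\in\mathbb R^n:\ \|\nabla f(z)\|^2\le\frac{\kappa_1}{\underline{\beta_2}\,\underline\phi\,\min\{\frac12\kappa_1\underline{\beta_1},\kappa_2\}}\Big\|\begin{bmatrix}d_{eq}\\ d_{ineq}\end{bmatrix}\Big\|^2\Big\}$$ is positively invariant. 2. For every $z_0\in\mathcal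 G_{ineq}$ there is a smallest sublevel set $\mathcal F0$ of $f$ that contains $\mathcal F$ and $z_0$, and it is positively invariant. 3. For every $z_0\in\mathcal G_{ineq}$ and every initial value $T_s(0)\in\mathbb R$ there is a solution $(z,\sigma,T_s)$ on $[0,\infty)$ with $z(0)=z_0$; $\sigma$ takes values in $\mathcal S$, $z$ is bounded, and $z$ is absolutely continuous on every interval $[0,t]$. It is unique: every solution on an interval $[0,L)$ with the same $z(0)$ and $T_s(0)$ coincides with it on $[0,L)$. (The constants $\phi_{\mathcal A}$ play no role in this part.) -/

import Mathlib

open Filter Topology Set MeasureTheory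
open scoped Matrix

noncomputable section

/-- Data of the optimisation problem `min f(z)` subject to `Aeq(z) ∇f(z) + deq = 0` and
`Aineq(z) ∇f(z) + dineq ≤ 0`, together with the design parameters of the optimisation dynamics:
the gains `κ₁, κ₂`, the dwell time `δT`, and for each set `A` of inequality indices a matrix
function `G A` with `n - m - |A|` rows (the left annihilator). -/
structure OptData (n m p : ℕ) where
  f : EuclideanSpace ℝ (Fin n) → ℝ
  Aeq : EuclideanSpace ℝ (Fin n) → Matrix (Fin m) (Fin n) ℝ
  Aineq : EuclideanSpace ℝ (Fin n) → Matrix (Fin p) (Fin n) ℝ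
  deq : Fin m → ℝ
  dineq : Fin p → ℝ
  κ₁ : ℝ
  κ₂ : ℝ
  δT : ℝ
  G : (A : Finset (Fin p)) → EuclideanSpace ℝ (Fin n) →
    Matrix (Fin (n - m - A.card)) (Fin n) ℝ

namespace OptData

variable {n m p : ℕ} (D : OptData n m p)

/-- The gradient of `f` as a coordinate vector. -/
def grad (z : EuclideanSpace ℝ (Fin n)) : Fin n → ℝ := (gradient D.f z).ofLp

/-- Equality constraint function. -/
def geq (z : EuclideanSpace ℝ (Fin n)) : Fin m → ℝ := D.Aeq z *ᵥ D.grad z + D.deq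

/-- Inequality constraint function. -/
def gineq (z : EuclideanSpace ℝ (Fin n)) : Fin p → ℝ := D.Aineq z *ᵥ D.grad z + D.dineq

/-- Jacobian matrix of `geq`. -/
def Jeq (z : EuclideanSpace ℝ (Fin n)) : Matrix (Fin m) (Fin n) ℝ :=
  Matrix.of fun i j => fderiv ℝ (fun w => D.geq w i) z (EuclideanSpace.single j 1)

/-- Jacobian matrix of `gineq`. -/
def Jineq (z : EuclideanSpace ℝ (Fin n)) : Matrix (Fin p) (Fin n) ℝ :=
  Matrix.of fun i j => fderiv ℝ (fun w => D.gineq w i) z (EuclideanSpace.single j 1)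

/-- The set on which the inequality constraints hold. -/
def Gineq : Set (EuclideanSpace ℝ (Fin n)) := {z | ∀ i, D.gineq z i ≤ 0}

open Classical in
/-- `I(z)`: the inequality constraints that hold with equality at `z`. -/
def act (z : EuclideanSpace ℝ (Fin n)) : Finset (Fin p) :=
  Finset.univ.filter fun i => D.gineq z i = 0

open Classical in
/-- The index set `S` of all sets of inequality constraints that can simultaneously hold with
equality. -/
def S : Finset (Finset (Fin p)) :=
  Finset.univ.filter fun s => ∃ z, s ⊆ D.act z

theorem S_nonempty : D.S.Nonempty :=
  ⟨∅, by simp [S]⟩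

/-- `A_A(z)`: the rows of `Aeq(z)` followed by the rows of `Aineq(z)` with index in `A`. -/
def AA (A : Finset (Fin p)) (z : EuclideanSpace ℝ (Fin n)) :
    Matrix (Fin m ⊕ {i // i ∈ A}) (Fin n) ℝ :=
  Matrix.fromRows (D.Aeq z) ((D.Aineq z).submatrix Subtype.val id)

/-- `d_A`: the entries of `deq` followed by the entries of `dineq` with index in `A`. -/
def dA (A : Finset (Fin p)) : Fin m ⊕ {i // i ∈ A} → ℝ :=
  Sum.elim D.deq fun i => D.dineq i.1

/-- Jacobian of the active constraint vector. -/
def JA (A : Finset (Fin p)) (z : EuclideanSpace ℝ (Fin n)) :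
    Matrix (Fin m ⊕ {i // i ∈ A}) (Fin n) ℝ :=
  Matrix.fromRows (D.Jeq z) ((D.Jineq z).submatrix Subtype.val id)

/-- `B_A(z) = (∂g_A/∂z)(z) A_A(z)ᵀ`. -/
def B (A : Finset (Fin p)) (z : EuclideanSpace ℝ (Fin n)) :
    Matrix (Fin m ⊕ {i // i ∈ A}) (Fin m ⊕ {i // i ∈ A}) ℝ :=
  D.JA A z * (D.AA A z)ᵀ

/-- The subsystem vector field
`h_A = -[κ₁ A_Aᵀ B_A⁻¹ A_A + κ₂ G_Aᵀ G_A] ∇f - κ₁ A_Aᵀ B_A⁻¹ d_A`. -/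
def h (A : Finset (Fin p)) (z : EuclideanSpace ℝ (Fin n)) : EuclideanSpace ℝ (Fin n) :=
  WithLp.toLp 2
    (-((D.κ₁ • ((D.AA A z)ᵀ * (D.B A z)⁻¹ * D.AA A z) + D.κ₂ • ((D.G A z)ᵀ * D.G A z))
        *ᵥ D.grad z)
      - D.κ₁ • (((D.AA A z)ᵀ * (D.B A z)⁻¹) *ᵥ D.dA A))

/-- Standing hypotheses on the data: positive parameters, `f` and `‖∇f‖` radially unbounded, the
regularity under which the subsystems are locally Lipschitz where `B_A` is invertible, and `G_A`
is a full-rank left annihilator of `(∂g_A/∂z)ᵀ` on the inequality-feasible set. -/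
structure Admissible : Prop where
  κ₁_pos : 0 < D.κ₁
  κ₂_pos : 0 < D.κ₂
  δT_pos : 0 < D.δT
  f_diff : Differentiable ℝ D.f
  f_unbounded : Tendsto D.f (cocompact _) atTop
  grad_unbounded : Tendsto (fun z => ‖gradient D.f z‖) (cocompact _) atTop
  grad_lip : LocallyLipschitz (gradient D.f)
  Aeq_lip : ∀ i j, LocallyLipschitz fun z => D.Aeq z i j
  Aineq_lip : ∀ i j, LocallyLipschitz fun z => D.Aineq z i j
  geq_diff : ∀ i, Differentiable ℝ fun z => D.geq z i
  gineq_diff : ∀ i, Differentiable ℝ fun z => D.gineq z i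
  Jeq_lip : ∀ i j, LocallyLipschitz fun z => D.Jeq z i j
  Jineq_lip : ∀ i j, LocallyLipschitz fun z => D.Jineq z i j
  G_lip : ∀ A ∈ D.S, ∀ i j, LocallyLipschitz fun z => D.G A z i j
  G_annihilates : ∀ A ∈ D.S, ∀ z ∈ D.Gineq, D.G A z * (D.JA A z)ᵀ = 0
  G_rank : ∀ A ∈ D.S, ∀ z ∈ D.Gineq, (D.G A z).rank = n - m - A.card

/-- The technical assumption with constants `β₁ A`, `β₂ A`: on the inequality-feasible set `B_A`
is invertible and `½(B_A + B_Aᵀ) ≥ ½ β₁ B_A B_Aᵀ ≥ β₂ I > 0`. -/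
def DampingBound (β₁ β₂ : Finset (Fin p) → ℝ) : Prop :=
  ∀ A ∈ D.S, 0 < β₁ A ∧ 0 < β₂ A ∧ ∀ z ∈ D.Gineq,
    IsUnit (D.B A z) ∧
    ((1 / 2 : ℝ) • (D.B A z + (D.B A z)ᵀ)
      - (1 / 2 * β₁ A) • (D.B A z * (D.B A z)ᵀ)).PosSemidef ∧
    ((1 / 2 * β₁ A) • (D.B A z * (D.B A z)ᵀ)
      - β₂ A • (1 : Matrix (Fin m ⊕ {i // i ∈ A}) (Fin m ⊕ {i // i ∈ A}) ℝ)).PosSemidef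

/-- The defining property of the constants `φ A`: `[A_A; G_A]ᵀ [A_A; G_A] > φ_A I` on the
inequality-feasible set. -/
def StackBound (φ : Finset (Fin p) → ℝ) : Prop :=
  ∀ A ∈ D.S, 0 < φ A ∧ ∀ z ∈ D.Gineq,
    ((Matrix.fromRows (D.AA A z) (D.G A z))ᵀ * Matrix.fromRows (D.AA A z) (D.G A z)
      - φ A • (1 : Matrix (Fin n) (Fin n) ℝ)).PosDef

/-- The minimum over `S` of a family of constants. -/
def minS (c : Finset (Fin p) → ℝ) : ℝ := D.S.inf' D.S_nonempty c

/-- The set `F`. -/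
def Fset (β₁ β₂ φ : Finset (Fin p) → ℝ) : Set (EuclideanSpace ℝ (Fin n)) :=
  {z | ‖gradient D.f z‖ ^ 2 ≤
    D.κ₁ / (D.minS β₂ * D.minS φ * min (1 / 2 * D.κ₁ * D.minS β₁) D.κ₂)
      * ‖WithLp.toLp 2 (Sum.elim D.deq D.dineq)‖ ^ 2}

/-- Sublevel sets of `f`. -/
def sublevel (c : ℝ) : Set (EuclideanSpace ℝ (Fin n)) := {z | D.f z ≤ c}

/-- `W` is the smallest sublevel set of `f` containing `K`. -/
def IsSmallestSublevel (W K : Set (EuclideanSpace ℝ (Fin n))) : Prop :=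
  (∃ c, W = D.sublevel c) ∧ K ⊆ W ∧ ∀ c, K ⊆ D.sublevel c → W ⊆ D.sublevel c

/-! ### The switching law

A mode `q = (σ, Tₛ)` consists of the active set and of the time of the last removal. -/

/-- The rate of change of the `i`-th inequality constraint along subsystem `A` at `z`. -/
def rate (i : Fin p) (A : Finset (Fin p)) (z : EuclideanSpace ℝ (Fin n)) : ℝ :=
  fderiv ℝ (fun w => D.gineq w i) z (D.h A z)

/-- `P s (y s)` holds at times `s > t` arbitrarily close to `t`, where `y` is the forward solution
of subsystem `A` that starts from `z` at time `t`. -/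
def FreqAfter (t : ℝ) (z : EuclideanSpace ℝ (Fin n)) (A : Finset (Fin p))
    (P : ℝ → EuclideanSpace ℝ (Fin n) → Prop) : Prop :=
  ∃ (ε : ℝ) (y : ℝ → EuclideanSpace ℝ (Fin n)), 0 < ε ∧ y t = z ∧
    (∀ s ∈ Ico t (t + ε), HasDerivWithinAt y (D.h A (y s)) (Ico t (t + ε)) s) ∧
    ∃ᶠ s in 𝓝[>] t, P s (y s)

open Classical in
/-- The indices that the first loop of the switching law adds at the state `z`. -/
def addNow (z : EuclideanSpace ℝ (Fin n)) (A : Finset (Fin p)) : Finset (Fin p) :=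
  Finset.univ.filter fun i => i ∈ D.act z \ A ∧ 0 ≤ D.rate i A z

open Classical in
/-- The indices that the first loop adds immediately after time `t`, if subsystem `A` is
integrated from the state `z`. -/
def addAfter (t : ℝ) (z : EuclideanSpace ℝ (Fin n)) (A : Finset (Fin p)) : Finset (Fin p) :=
  Finset.univ.filter fun i => i ∈ D.act z \ A ∧ D.FreqAfter t z A fun _ y => 0 ≤ D.rate i A y

/-- The second loop removes `i` at time `t`, or immediately after it: `i` is active, and at times
`s > t` arbitrarily close to `t` the constraint would decrease along subsystem `σ \ {i}`, and
`s > Tₛ + δT`. -/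
def RemovalDue (t : ℝ) (z : EuclideanSpace ℝ (Fin n)) (q : Finset (Fin p) × ℝ) (i : Fin p) :
    Prop :=
  i ∈ q.1 ∧ D.FreqAfter t z q.1 fun s y => D.rate i (q.1.erase i) y < 0 ∧ q.2 + D.δT < s

/-- One update of the mode: pending additions are made; if there are none, then the first index
whose removal is due is removed and `Tₛ` is set to `t`. -/
def Update (t : ℝ) (z : EuclideanSpace ℝ (Fin n)) (q q' : Finset (Fin p) × ℝ) : Prop :=
  ((D.addAfter t z q.1).Nonempty ∧ q' = (q.1 ∪ D.addAfter t z q.1, q.2)) ∨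
  (D.addAfter t z q.1 = ∅ ∧ ∃ i, D.RemovalDue t z q i ∧ (∀ j < i, ¬ D.RemovalDue t z q j) ∧
    q' = (q.1.erase i, t))

/-- The switching law maps the mode `q = q(t)` to `q' = q(t⁺)`: the first loop is executed at the
state `z = z(t)`, and then the mode is updated until no update is triggered any more. -/
def Switch (t : ℝ) (z : EuclideanSpace ℝ (Fin n)) (q q' : Finset (Fin p) × ℝ) : Prop :=
  Relation.ReflTransGen (D.Update t z) (q.1 ∪ D.addNow z q.1, q.2) q' ∧
    ∀ q'', ¬ D.Update t z q' q''

/-- The time interval `[0, L)`, with `L = ⊤` allowed. -/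
def horizon (L : EReal) : Set ℝ := {t | 0 ≤ t ∧ (t : EReal) < L}

/-- `(z, q)` with `q = (σ, Tₛ)` is a (Carathéodory) solution of the switched system on `[0, L)`:
`σ(0) = I(z(0))`, `z(t) = z(0) + ∫₀ᵗ h_{σ(τ)}(z(τ)) dτ`, and `q` is piecewise constant with
left-continuous values and with right limits `q(t⁺)` given by the switching law. -/
structure IsSolution (L : EReal) (z : ℝ → EuclideanSpace ℝ (Fin n))
    (q : ℝ → Finset (Fin p) × ℝ) : Prop where
  init : (q 0).1 = D.act (z 0)
  integrable : ∀ t ∈ horizon L,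
    IntervalIntegrable (fun τ => D.h (q τ).1 (z τ)) volume 0 t
  integral_eq : ∀ t ∈ horizon L, z t = z 0 + ∫ τ in (0 : ℝ)..t, D.h (q τ).1 (z τ)
  left_const : ∀ t ∈ horizon L, 0 < t → ∀ᶠ s in 𝓝[<] t, q s = q t
  switch : ∀ t ∈ horizon L, ∃ q', D.Switch t (z t) (q t) q' ∧ ∀ᶠ s in 𝓝[>] t, q s = q'

/-- Solutions of the switched system that start in the inequality-feasible set do not leave `W`
once they are in `W`. -/
def PositivelyInvariant (W : Set (EuclideanSpace ℝ (Fin n))) : Prop :=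
  ∀ (L : EReal) (z : ℝ → EuclideanSpace ℝ (Fin n)) (q : ℝ → Finset (Fin p) × ℝ),
    D.IsSolution L z q → z 0 ∈ D.Gineq →
    ∀ s ∈ horizon L, ∀ t ∈ horizon L, s ≤ t → z s ∈ W → z t ∈ W

end OptData

end

/-! Along subsystem `A`, the inverse of `B_A` and the annihilator `G_A` give `ġ_A = -κ₁ g_A` at
feasible points: active inequality constraints stay at zero and equality constraints decay
exponentially.

Invariance of sublevel sets. With `v = A_A ∇f` and `x = B_A⁻ᵀ v`, the derivative of `f` is `-κ₁ (x·v
+ x·d_A) - κ₂ ‖G_A ∇f‖²`. The damping bounds control `‖v‖²` and `‖x‖²` by `x·v`; Young's inequality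
absorbs `x·d_A`, and what is left is negative outside `F` (`fderiv_f_h_neg`). A barrier argument
then applies to any sublevel set containing `F`.

Feasibility. The identity `G_A J_Aᵀ = 0` is known only on the feasible set, which the flow might
leave. Since `J_A` is onto, the distance to the feasible set is bounded by the violation of the
active constraints (`exists_mem_Gineq_dist_le`). The error term of `ġ_A` is locally Lipschitz and
vanishes at feasible points, so it is bounded by that violation, and Grönwall's inequality keeps the
constraints in `A` at zero. When the switching law has stopped, the remaining active constraints
strictly decrease; hence the flow stays feasible with active set exactly `A`
(`eventually_feasible`), and no further switch occurs for a while.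

Well-posedness. Update steps are deterministic, and the dwell time allows at most one removal at
each instant, so the law terminates. Uniqueness follows from Picard–Lindelöf by induction along the
interval. Near the end of a bounded interval no removal occurs, and active sets can then only grow,
so the mode is eventually constant. Boundedness needs no `φ`: when the constraints in `A` vanish,
`f` grows at most like `∑ |g_eq|`, which is integrable in time. A solution is therefore Lipschitz,
has a limit at a finite end point and can be continued; gluing yields a solution on `[0, ∞)`. -/

/-! ### Calculus of functions that are Lipschitz near a point -/

/-- `f` is Lipschitz on some neighbourhood of `x`. -/
def LipAt {X Y : Type*} [PseudoMetricSpace X] [PseudoMetricSpace Y] (f : X → Y) (x : X) : Prop :=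
  ∃ K, ∃ s ∈ 𝓝 x, LipschitzOnWith K f s

namespace LipAt

variable {X : Type*} [PseudoMetricSpace X] {x : X}

theorem continuousAt {Y : Type*} [PseudoMetricSpace Y] {f : X → Y} (hf : LipAt f x) :
    ContinuousAt f x := by
  obtain ⟨K, s, hs, h⟩ := hf
  exact h.continuousOn.continuousAt hs

theorem const {Y : Type*} [PseudoMetricSpace Y] (c : Y) : LipAt (fun _ : X => c) x :=
  ⟨0, univ, univ_mem, (LipschitzWith.const c).lipschitzOnWith⟩

theorem prodMk {Y Z : Type*} [PseudoMetricSpace Y] [PseudoMetricSpace Z] {f : X → Y} {g : X → Z}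
    (hf : LipAt f x) (hg : LipAt g x) : LipAt (fun z => (f z, g z)) x := by
  obtain ⟨K, s, hs, h⟩ := hf
  obtain ⟨K', s', hs', h'⟩ := hg
  exact ⟨_, s ∩ s', inter_mem hs hs',
    (h.mono inter_subset_left).prodMk (h'.mono inter_subset_right)⟩

/-- A C¹ map is Lipschitz near each point, so all the arithmetic rules below reduce to smoothness of
the operation. -/
theorem comp_contDiffAt {Y Z : Type*} [NormedAddCommGroup Y] [NormedSpace ℝ Y]
    [NormedAddCommGroup Z] [NormedSpace ℝ Z] {g : Y → Z} {f : X → Y}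
    (hg : ContDiffAt ℝ 1 g (f x)) (hf : LipAt f x) : LipAt (fun z => g (f z)) x := by
  obtain ⟨K, t, ht, h⟩ := hg.exists_lipschitzOnWith
  have hc := hf.continuousAt.preimage_mem_nhds ht
  obtain ⟨K', s, hs, h'⟩ := hf
  exact ⟨K * K', s ∩ f ⁻¹' t, inter_mem hs hc,
    h.comp (h'.mono inter_subset_left) fun z hz => hz.2⟩

variable {f g : X → ℝ}

theorem add (hf : LipAt f x) (hg : LipAt g x) : LipAt (fun z => f z + g z) x :=
  comp_contDiffAt (g := fun q : ℝ × ℝ => q.1 + q.2) (by fun_prop) (hf.prodMk hg)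

theorem mul (hf : LipAt f x) (hg : LipAt g x) : LipAt (fun z => f z * g z) x :=
  comp_contDiffAt (g := fun q : ℝ × ℝ => q.1 * q.2) (by fun_prop) (hf.prodMk hg)

theorem sub (hf : LipAt f x) (hg : LipAt g x) : LipAt (fun z => f z - g z) x :=
  comp_contDiffAt (g := fun q : ℝ × ℝ => q.1 - q.2) (by fun_prop) (hf.prodMk hg)

theorem neg (hf : LipAt f x) : LipAt (fun z => -f z) x :=
  comp_contDiffAt (g := fun q : ℝ => -q) (by fun_prop) hf

theorem inv (hf : LipAt f x) (h0 : f x ≠ 0) : LipAt (fun z => (f z)⁻¹) x :=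
  comp_contDiffAt (contDiffAt_inv ℝ h0) hf

theorem sum {ι : Type*} (s : Finset ι) {F : ι → X → ℝ} (h : ∀ i ∈ s, LipAt (F i) x) :
    LipAt (fun z => ∑ i ∈ s, F i z) x := by
  classical
  induction s using Finset.induction_on with
  | empty => simpa using const 0
  | insert a s ha ih =>
    simp only [Finset.sum_insert ha]
    exact (h _ (by simp)).add (ih fun i hi => h i (by simp [hi]))

theorem prod {ι : Type*} (s : Finset ι) {F : ι → X → ℝ} (h : ∀ i ∈ s, LipAt (F i) x) :
    LipAt (fun z => ∏ i ∈ s, F i z) x := by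
  classical
  induction s using Finset.induction_on with
  | empty => simpa using const 1
  | insert a s ha ih =>
    simp only [Finset.prod_insert ha]
    exact (h _ (by simp)).mul (ih fun i hi => h i (by simp [hi]))

theorem pi {ι : Type*} [Fintype ι] {F : X → ι → ℝ} (h : ∀ i, LipAt (fun z => F z i) x) :
    LipAt F x := by
  choose K s hs hK using h
  refine ⟨Finset.univ.sup K, ⋂ i, s i, Filter.iInter_mem.2 hs, ?_⟩
  rw [lipschitzOnWith_iff_dist_le_mul]
  intro a ha b hb
  rw [dist_pi_le_iff (by positivity)]
  intro i
  have h1 := (hK i).dist_le_mul a (mem_iInter.1 ha i) b (mem_iInter.1 hb i)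
  have h2 : K i ≤ Finset.univ.sup K := Finset.le_sup (Finset.mem_univ i)
  calc _ ≤ _ := h1
    _ ≤ _ := by gcongr

theorem toLp {n : ℕ} {F : X → Fin n → ℝ} (h : ∀ i, LipAt (fun z => F z i) x) :
    LipAt (fun z => WithLp.toLp 2 (F z)) x :=
  comp_contDiffAt (g := fun v : Fin n → ℝ => WithLp.toLp 2 v)
    ((EuclideanSpace.equiv (Fin n) ℝ).symm.contDiff.contDiffAt) (pi h)

/-! ### Matrix-valued functions, entrywise -/

variable {a b c : Type*} [Fintype a]

theorem matrix_mul {M : X → Matrix c a ℝ} {N : X → Matrix a b ℝ}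
    (hM : ∀ i j, LipAt (fun z => M z i j) x) (hN : ∀ i j, LipAt (fun z => N z i j) x)
    (i : c) (j : b) : LipAt (fun z => (M z * N z) i j) x := by
  simp only [Matrix.mul_apply]
  exact sum _ fun k _ => (hM i k).mul (hN k j)

theorem matrix_mulVec {M : X → Matrix c a ℝ} {v : X → a → ℝ}
    (hM : ∀ i j, LipAt (fun z => M z i j) x) (hv : ∀ i, LipAt (fun z => v z i) x)
    (i : c) : LipAt (fun z => (M z *ᵥ v z) i) x := by
  simp only [Matrix.mulVec, dotProduct]
  exact sum _ fun k _ => (hM i k).mul (hv k)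

theorem matrix_det [DecidableEq a] {M : X → Matrix a a ℝ}
    (hM : ∀ i j, LipAt (fun z => M z i j) x) : LipAt (fun z => (M z).det) x := by
  simp only [Matrix.det_apply']
  exact sum _ fun σ _ => (const _).mul (prod _ fun i _ => hM _ _)

/-- By Cramer's rule each entry is a quotient of determinants, and the denominator does not vanish
at `x`. -/
theorem matrix_inv [DecidableEq a] {M : X → Matrix a a ℝ}
    (hM : ∀ i j, LipAt (fun z => M z i j) x) (hu : IsUnit (M x)) (i j : a) :
    LipAt (fun z => (M z)⁻¹ i j) x := by
  have hd : (M x).det ≠ 0 := ((Matrix.isUnit_iff_isUnit_det _).1 hu).ne_zero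
  simp only [Matrix.inv_def, Ring.inverse_eq_inv', Matrix.smul_apply, smul_eq_mul,
    Matrix.adjugate_apply]
  refine ((matrix_det hM).inv hd).mul (matrix_det fun k l => ?_)
  by_cases hk : k = j
  · subst hk
    simpa using const _
  · simpa [Matrix.updateRow_ne hk] using hM k l

end LipAt

/-! ### Regularity of the vector fields -/

namespace OptData

variable {n m p : ℕ} {D : OptData n m p}

/-- The component of the vector field produced by the annihilator `G`, as seen by the inequality
constraints; it vanishes on the feasible set for active constraints. -/
noncomputable def residual (D : OptData n m p) (A : Finset (Fin p))
    (z : EuclideanSpace ℝ (Fin n)) : Fin p → ℝ :=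
  (D.Jineq z * ((D.G A z)ᵀ * D.G A z)) *ᵥ D.grad z

namespace Admissible

variable {A : Finset (Fin p)} {z : EuclideanSpace ℝ (Fin n)}

theorem lipAt_grad (hD : D.Admissible) (j : Fin n) : LipAt (fun z => D.grad z j) z :=
  LipAt.comp_contDiffAt (g := fun v : EuclideanSpace ℝ (Fin n) => v j)
    (EuclideanSpace.proj (𝕜 := ℝ) j).contDiff.contDiffAt (hD.grad_lip z)

theorem lipAt_AA (hD : D.Admissible) (i : Fin m ⊕ {i // i ∈ A}) (j : Fin n) :
    LipAt (fun z => D.AA A z i j) z := by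
  cases i with
  | inl i => exact hD.Aeq_lip i j z
  | inr i => exact hD.Aineq_lip i j z

theorem lipAt_JA (hD : D.Admissible) (i : Fin m ⊕ {i // i ∈ A}) (j : Fin n) :
    LipAt (fun z => D.JA A z i j) z := by
  cases i with
  | inl i => exact hD.Jeq_lip i j z
  | inr i => exact hD.Jineq_lip i j z

theorem lipAt_B (hD : D.Admissible) (i j : Fin m ⊕ {i // i ∈ A}) : LipAt (fun z => D.B A z i j) z :=
  LipAt.matrix_mul hD.lipAt_JA (fun i j => hD.lipAt_AA j i) i j

/-- Invertibility of `B_A` is guaranteed only on the feasible set, which is why regularity is stated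
pointwise. -/
theorem lipAt_h (hD : D.Admissible) (hA : A ∈ D.S) (hB : IsUnit (D.B A z)) : LipAt (D.h A) z := by
  have h1 : ∀ i j, LipAt (fun z => ((D.AA A z)ᵀ * (D.B A z)⁻¹) i j) z :=
    LipAt.matrix_mul (M := fun z => (D.AA A z)ᵀ) (fun i j => hD.lipAt_AA j i)
      (LipAt.matrix_inv hD.lipAt_B hB)
  have h2 : ∀ i j, LipAt (fun z => ((D.AA A z)ᵀ * (D.B A z)⁻¹ * D.AA A z) i j) z :=
    LipAt.matrix_mul (M := fun z => (D.AA A z)ᵀ * (D.B A z)⁻¹) h1 hD.lipAt_AA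
  have h3 : ∀ i j, LipAt (fun z => ((D.G A z)ᵀ * D.G A z) i j) z :=
    LipAt.matrix_mul (M := fun z => (D.G A z)ᵀ) (fun i j => hD.G_lip A hA j i z)
      (fun i j => hD.G_lip A hA i j z)
  have h4 : ∀ i j, LipAt (fun z => (D.κ₁ • ((D.AA A z)ᵀ * (D.B A z)⁻¹ * D.AA A z)
      + D.κ₂ • ((D.G A z)ᵀ * D.G A z)) i j) z := fun i j =>
    ((LipAt.const D.κ₁).mul (h2 i j)).add ((LipAt.const D.κ₂).mul (h3 i j))
  have h5 := LipAt.matrix_mulVec h4 (v := D.grad) fun j => hD.lipAt_grad j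
  have h6 := LipAt.matrix_mulVec h1 (v := fun _ => D.dA A) fun j => LipAt.const _
  exact LipAt.toLp fun i => (h5 i).neg.sub ((LipAt.const D.κ₁).mul (h6 i))

theorem lipAt_residual (hD : D.Admissible) (hA : A ∈ D.S) : LipAt (D.residual A) z :=
  LipAt.pi <| LipAt.matrix_mulVec
    (LipAt.matrix_mul (fun i j => hD.Jineq_lip i j z)
      (LipAt.matrix_mul (fun i j => hD.G_lip A hA j i z) (fun i j => hD.G_lip A hA i j z)))
    fun j => hD.lipAt_grad j

theorem continuous_gineq (hD : D.Admissible) (i : Fin p) : Continuous fun z => D.gineq z i :=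
  (hD.gineq_diff i).continuous

theorem isClosed_Gineq (hD : D.Admissible) : IsClosed D.Gineq := by
  simp only [Gineq, ofPred_forall]
  exact isClosed_iInter fun i => isClosed_le (hD.continuous_gineq i) continuous_const

/-- The determinant is continuous. This makes the formulas for constraint rates available at nearby
points not yet known to be feasible. -/
theorem eventually_isUnit_B (hD : D.Admissible) (h : IsUnit (D.B A z)) :
    ∀ᶠ w in 𝓝 z, IsUnit (D.B A w) := by
  have hc := (LipAt.matrix_det (hD.lipAt_B (A := A) (z := z))).continuousAt
  have hd : (D.B A z).det ≠ 0 := ((Matrix.isUnit_iff_isUnit_det _).1 h).ne_zero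
  filter_upwards [hc.eventually_ne hd] with w hw
  exact (Matrix.isUnit_iff_isUnit_det _).2 (isUnit_iff_ne_zero.2 hw)

end Admissible

end OptData

/-! ### Derivatives of the constraints and of the objective along a subsystem -/

theorem dotProduct_self_nonneg_real {ι : Type*} [Fintype ι] (x : ι → ℝ) : 0 ≤ x ⬝ᵥ x :=
  Finset.sum_nonneg fun i _ => mul_self_nonneg (x i)

/-- Young's inequality for the dot product. -/
theorem neg_dotProduct_le {ι : Type*} [Fintype ι] {b : ℝ} (hb : 0 < b) (x d : ι → ℝ) :
    -(x ⬝ᵥ d) ≤ b / 2 * (x ⬝ᵥ x) + (d ⬝ᵥ d) / (2 * b) := by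
  simp only [dotProduct, Finset.mul_sum, Finset.sum_div, ← Finset.sum_neg_distrib,
    ← Finset.sum_add_distrib]
  refine Finset.sum_le_sum fun i _ => ?_
  have h : b / 2 * (x i * x i) + d i * d i / (2 * b) - -(x i * d i)
      = (b * x i + d i) ^ 2 / (2 * b) := by
    field_simp
    ring
  have : 0 ≤ (b * x i + d i) ^ 2 / (2 * b) := by positivity
  linarith

theorem fderiv_apply_eq_sum {n : ℕ} (L : EuclideanSpace ℝ (Fin n) →L[ℝ] ℝ)
    (v : EuclideanSpace ℝ (Fin n)) :
    L v = ∑ j, L (EuclideanSpace.single j 1) * v j := by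
  have hv : v = ∑ j, v j • EuclideanSpace.single j (1 : ℝ) := by
    ext k
    simp [Finset.sum_apply, Pi.single_apply]
  conv_lhs => rw [hv]
  simp [mul_comm]

namespace OptData

variable {n m p : ℕ} {D : OptData n m p} {A : Finset (Fin p)} {z : EuclideanSpace ℝ (Fin n)}

theorem rate_eq (i : Fin p) : D.rate i A z = (D.Jineq z *ᵥ (D.h A z).ofLp) i := by
  rw [rate, fderiv_apply_eq_sum]
  rfl

theorem fderiv_geq_eq (i : Fin m) (v : EuclideanSpace ℝ (Fin n)) :
    fderiv ℝ (fun w => D.geq w i) z v = (D.Jeq z *ᵥ v.ofLp) i := by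
  rw [fderiv_apply_eq_sum]
  rfl

/-- The active constraint vector. -/
noncomputable def gA (D : OptData n m p) (A : Finset (Fin p)) (z : EuclideanSpace ℝ (Fin n)) :
    Fin m ⊕ {i // i ∈ A} → ℝ :=
  D.AA A z *ᵥ D.grad z + D.dA A

theorem gA_eq : D.gA A z = Sum.elim (D.geq z) fun i => D.gineq z i.1 := by
  funext i
  cases i <;> rfl

theorem JA_mulVec (v : Fin n → ℝ) :
    D.JA A z *ᵥ v = Sum.elim (D.Jeq z *ᵥ v) fun i => (D.Jineq z *ᵥ v) i.1 := by
  funext i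
  cases i <;> rfl

theorem h_eq : (D.h A z).ofLp = -(D.κ₁ • ((D.AA A z)ᵀ *ᵥ ((D.B A z)⁻¹ *ᵥ D.gA A z)))
    - D.κ₂ • (((D.G A z)ᵀ * D.G A z) *ᵥ D.grad z) := by
  simp only [h, gA, Matrix.add_mulVec, Matrix.mulVec_add, Matrix.smul_mulVec, smul_add,
    Matrix.mulVec_mulVec, Matrix.mul_assoc]
  abel

/-- `B_A` cancels against its inverse. The `G` term is kept because it is known to vanish only at
feasible points, and feasibility of the flow is proved from this formula. -/
theorem JA_mulVec_h (hB : IsUnit (D.B A z)) :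
    D.JA A z *ᵥ (D.h A z).ofLp = -(D.κ₁ • D.gA A z)
      - D.κ₂ • (D.JA A z *ᵥ (((D.G A z)ᵀ * D.G A z) *ᵥ D.grad z)) := by
  rw [h_eq, Matrix.mulVec_sub, Matrix.mulVec_neg, Matrix.mulVec_smul, Matrix.mulVec_smul,
    Matrix.mulVec_mulVec _ (D.JA A z) (D.AA A z)ᵀ, ← B, Matrix.mulVec_mulVec,
    Matrix.mul_nonsing_inv _ ((Matrix.isUnit_iff_isUnit_det _).1 hB), Matrix.one_mulVec]

theorem rate_of_mem (hB : IsUnit (D.B A z)) {i : Fin p} (hi : i ∈ A) :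
    D.rate i A z = -(D.κ₁ * D.gineq z i) - D.κ₂ * D.residual A z i := by
  have h := congrFun (JA_mulVec_h hB) (Sum.inr ⟨i, hi⟩)
  rw [JA_mulVec, gA_eq, JA_mulVec] at h
  simp only [Sum.elim_inr, Pi.sub_apply, Pi.neg_apply, Pi.smul_apply, smul_eq_mul] at h
  rw [rate_eq, h, residual, Matrix.mulVec_mulVec]

namespace Admissible

theorem JA_mulVec_G (hD : D.Admissible) (hA : A ∈ D.S) (hz : z ∈ D.Gineq) :
    D.JA A z *ᵥ (((D.G A z)ᵀ * D.G A z) *ᵥ D.grad z) = 0 := by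
  have h : D.JA A z * (D.G A z)ᵀ = 0 := by
    rw [← Matrix.transpose_transpose (D.JA A z), ← Matrix.transpose_mul,
      hD.G_annihilates A hA z hz, Matrix.transpose_zero]
  rw [Matrix.mulVec_mulVec, ← Matrix.mul_assoc, h, Matrix.zero_mul, Matrix.zero_mulVec]

theorem residual_eq_zero (hD : D.Admissible) (hA : A ∈ D.S) (hz : z ∈ D.Gineq) {i : Fin p}
    (hi : i ∈ A) : D.residual A z i = 0 := by
  have h := congrFun (hD.JA_mulVec_G hA hz) (Sum.inr ⟨i, hi⟩)
  rw [JA_mulVec] at h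
  rw [residual, ← Matrix.mulVec_mulVec]
  exact h

theorem fderiv_geq_h (hD : D.Admissible) (hA : A ∈ D.S) (hz : z ∈ D.Gineq)
    (hB : IsUnit (D.B A z)) (i : Fin m) :
    fderiv ℝ (fun w => D.geq w i) z (D.h A z) = -(D.κ₁ * D.geq z i) := by
  have h := congrFun (JA_mulVec_h hB) (Sum.inl i)
  rw [hD.JA_mulVec_G hA hz, JA_mulVec, gA_eq] at h
  rw [fderiv_geq_eq]
  simpa using h

end Admissible

theorem fderiv_f_h : fderiv ℝ D.f z (D.h A z)
    = -(D.κ₁ * ((D.AA A z *ᵥ D.grad z) ⬝ᵥ ((D.B A z)⁻¹ *ᵥ D.gA A z)))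
      - D.κ₂ * ((D.G A z *ᵥ D.grad z) ⬝ᵥ (D.G A z *ᵥ D.grad z)) := by
  rw [← inner_gradient_left, EuclideanSpace.inner_eq_star_dotProduct, star_trivial, h_eq,
    dotProduct_comm, dotProduct_sub, dotProduct_neg, dotProduct_smul, dotProduct_smul,
    smul_eq_mul, smul_eq_mul]
  have h1 : D.grad z ⬝ᵥ (D.AA A z)ᵀ *ᵥ ((D.B A z)⁻¹ *ᵥ D.gA A z)
      = (D.AA A z *ᵥ D.grad z) ⬝ᵥ ((D.B A z)⁻¹ *ᵥ D.gA A z) := by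
    rw [Matrix.dotProduct_mulVec, Matrix.vecMul_transpose]
  have h2 : D.grad z ⬝ᵥ ((D.G A z)ᵀ * D.G A z) *ᵥ D.grad z
      = (D.G A z *ᵥ D.grad z) ⬝ᵥ (D.G A z *ᵥ D.grad z) := by
    rw [← Matrix.mulVec_mulVec, Matrix.dotProduct_mulVec, Matrix.vecMul_transpose]
  rw [← h1, ← h2]
  rfl

theorem minS_pos {c : Finset (Fin p) → ℝ} (h : ∀ A ∈ D.S, 0 < c A) : 0 < D.minS c :=
  (Finset.lt_inf'_iff _).2 h

theorem minS_le {c : Finset (Fin p) → ℝ} (hA : A ∈ D.S) : D.minS c ≤ c A :=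
  Finset.inf'_le _ hA

theorem dA_dotProduct_le :
    D.dA A ⬝ᵥ D.dA A ≤ ‖WithLp.toLp 2 (Sum.elim D.deq D.dineq)‖ ^ 2 := by
  rw [EuclideanSpace.real_norm_sq_eq]
  simp only [dotProduct, Fintype.sum_sum_type, dA, Sum.elim_inl, Sum.elim_inr, ← sq]
  gcongr
  rw [Finset.sum_coe_sort A fun i => D.dineq i ^ 2]
  exact Finset.sum_le_sum_of_subset_of_nonneg (Finset.subset_univ _) fun i _ _ => sq_nonneg _

/-! ### Estimates for the growth of the objective -/

namespace DampingBound

variable {β₁ β₂ : Finset (Fin p) → ℝ}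

theorem isUnit_B (hβ : D.DampingBound β₁ β₂) (hA : A ∈ D.S) (hz : z ∈ D.Gineq) :
    IsUnit (D.B A z) := ((hβ A hA).2.2 z hz).1

theorem quadratic_le (hβ : D.DampingBound β₁ β₂) (hA : A ∈ D.S) (hz : z ∈ D.Gineq)
    (x : Fin m ⊕ {i // i ∈ A} → ℝ) :
    1 / 2 * β₁ A * (((D.B A z)ᵀ *ᵥ x) ⬝ᵥ ((D.B A z)ᵀ *ᵥ x)) ≤ x ⬝ᵥ ((D.B A z)ᵀ *ᵥ x) := by
  have h := ((hβ A hA).2.2 z hz).2.1.dotProduct_mulVec_nonneg x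
  have h1 : x ⬝ᵥ (D.B A z *ᵥ x) = x ⬝ᵥ ((D.B A z)ᵀ *ᵥ x) := by
    rw [Matrix.dotProduct_mulVec, ← Matrix.mulVec_transpose, dotProduct_comm]
  have h2 : x ⬝ᵥ ((D.B A z * (D.B A z)ᵀ) *ᵥ x)
      = ((D.B A z)ᵀ *ᵥ x) ⬝ᵥ ((D.B A z)ᵀ *ᵥ x) := by
    rw [← Matrix.mulVec_mulVec, Matrix.dotProduct_mulVec, ← Matrix.mulVec_transpose]
  simp only [star_trivial, Matrix.sub_mulVec, Matrix.smul_mulVec, Matrix.add_mulVec,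
    dotProduct_sub, dotProduct_smul, dotProduct_add, smul_eq_mul, h1, h2] at h
  linarith

theorem le_quadratic (hβ : D.DampingBound β₁ β₂) (hA : A ∈ D.S) (hz : z ∈ D.Gineq)
    (x : Fin m ⊕ {i // i ∈ A} → ℝ) :
    β₂ A * (x ⬝ᵥ x) ≤ 1 / 2 * β₁ A * (((D.B A z)ᵀ *ᵥ x) ⬝ᵥ ((D.B A z)ᵀ *ᵥ x)) := by
  have h := ((hβ A hA).2.2 z hz).2.2.dotProduct_mulVec_nonneg x
  have h2 : x ⬝ᵥ ((D.B A z * (D.B A z)ᵀ) *ᵥ x)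
      = ((D.B A z)ᵀ *ᵥ x) ⬝ᵥ ((D.B A z)ᵀ *ᵥ x) := by
    rw [← Matrix.mulVec_mulVec, Matrix.dotProduct_mulVec, ← Matrix.mulVec_transpose]
  simp only [star_trivial, Matrix.sub_mulVec, Matrix.smul_mulVec, Matrix.one_mulVec,
    dotProduct_sub, dotProduct_smul, smul_eq_mul, h2] at h
  linarith

/-- The damping bounds are stated for `Bᵀ` without inverses; the substitution `x = B⁻ᵀ v` brings the
terms with `B⁻¹` into that form. -/
theorem exists_transpose_mulVec_eq (hβ : D.DampingBound β₁ β₂) (hA : A ∈ D.S) (hz : z ∈ D.Gineq)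
    (v : Fin m ⊕ {i // i ∈ A} → ℝ) :
    ∃ x, (D.B A z)ᵀ *ᵥ x = v ∧ ∀ w, v ⬝ᵥ ((D.B A z)⁻¹ *ᵥ w) = x ⬝ᵥ w := by
  have hu := (Matrix.isUnit_iff_isUnit_det _).1 (hβ.isUnit_B hA hz)
  refine ⟨((D.B A z)⁻¹)ᵀ *ᵥ v, ?_, fun w => ?_⟩
  · rw [Matrix.mulVec_mulVec, ← Matrix.transpose_mul, Matrix.nonsing_inv_mul _ hu,
      Matrix.transpose_one, Matrix.one_mulVec]
  · rw [Matrix.dotProduct_mulVec, Matrix.mulVec_transpose]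

/-- Outside `F` every subsystem strictly decreases the objective. -/
theorem fderiv_f_h_neg (hD : D.Admissible) (hβ : D.DampingBound β₁ β₂)
    {φ : Finset (Fin p) → ℝ} (hφ : D.StackBound φ) (hA : A ∈ D.S) (hz : z ∈ D.Gineq)
    (hF : z ∉ D.Fset β₁ β₂ φ) : fderiv ℝ D.f z (D.h A z) < 0 := by
  have hκ₁ := hD.κ₁_pos
  have hκ₂ := hD.κ₂_pos
  have hb1 := minS_pos fun A hA => (hβ A hA).1
  have hb2 := minS_pos fun A hA => (hβ A hA).2.1
  have hp := minS_pos fun A hA => (hφ A hA).1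
  have hb1A : D.minS β₁ ≤ β₁ A := minS_le hA
  have hb2A : D.minS β₂ ≤ β₂ A := minS_le hA
  have hpA : D.minS φ ≤ φ A := minS_le hA
  set b1 := D.minS β₁
  set b2 := D.minS β₂
  set ph := D.minS φ
  set μ := min (1 / 2 * D.κ₁ * b1) D.κ₂ with hμ
  have hμ0 : 0 < μ := lt_min (by positivity) hκ₂
  have hμ1 : μ ≤ 1 / 2 * D.κ₁ * b1 := min_le_left _ _
  have hμ2 : μ ≤ D.κ₂ := min_le_right _ _
  set d2 := ‖WithLp.toLp 2 (Sum.elim D.deq D.dineq)‖ ^ 2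
  have hd := dA_dotProduct_le (D := D) (A := A)
  obtain ⟨x, hx, hxw⟩ := hβ.exists_transpose_mulVec_eq hA hz (D.AA A z *ᵥ D.grad z)
  have q1 := hβ.quadratic_le hA hz x
  have q2 := hβ.le_quadratic hA hz x
  have hF' : D.κ₁ / (b2 * ph * μ) * d2 < D.grad z ⬝ᵥ D.grad z := by
    have h := hF
    rw [Fset, mem_ofPred_eq, not_le, EuclideanSpace.real_norm_sq_eq (gradient D.f z)] at h
    simp only [dotProduct, ← sq]
    exact h
  have hs : φ A * (D.grad z ⬝ᵥ D.grad z)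
      ≤ (D.AA A z *ᵥ D.grad z) ⬝ᵥ (D.AA A z *ᵥ D.grad z)
        + (D.G A z *ᵥ D.grad z) ⬝ᵥ (D.G A z *ᵥ D.grad z) := by
    have h := ((hφ A hA).2 z hz).posSemidef.dotProduct_mulVec_nonneg (D.grad z)
    rw [star_trivial, Matrix.sub_mulVec, dotProduct_sub, Matrix.smul_mulVec, Matrix.one_mulVec,
      dotProduct_smul, ← Matrix.mulVec_mulVec, Matrix.dotProduct_mulVec, Matrix.vecMul_transpose,
      Matrix.fromRows_mulVec] at h
    simp only [dotProduct, Fintype.sum_sum_type, Sum.elim_inl, Sum.elim_inr, smul_eq_mul] at h ⊢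
    linarith
  -- The weight `b2` is chosen so that the term in `‖x‖²` costs at most half of `Q`.
  have hy := neg_dotProduct_le hb2 x (D.dA A)
  have hx0 := dotProduct_self_nonneg_real x
  have hv0 := dotProduct_self_nonneg_real (D.AA A z *ᵥ D.grad z)
  have hg0 := dotProduct_self_nonneg_real (D.G A z *ᵥ D.grad z)
  have hgr0 := dotProduct_self_nonneg_real (D.grad z)
  rw [fderiv_f_h, gA, hxw, dotProduct_add]
  rw [hx] at q1 q2
  set X := x ⬝ᵥ x
  set V := (D.AA A z *ᵥ D.grad z) ⬝ᵥ (D.AA A z *ᵥ D.grad z)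
  set Y := (D.G A z *ᵥ D.grad z) ⬝ᵥ (D.G A z *ᵥ D.grad z)
  set W := D.grad z ⬝ᵥ D.grad z
  set Q := x ⬝ᵥ (D.AA A z *ᵥ D.grad z)
  set P := x ⬝ᵥ D.dA A
  set d' := D.dA A ⬝ᵥ D.dA A
  have e1 : b2 * X ≤ Q := by nlinarith
  have e2 : 1 / 2 * b1 * V ≤ Q := by nlinarith
  have e3 : d' / (2 * b2) ≤ d2 / (2 * b2) := by gcongr
  have e4 : D.κ₁ * d2 < b2 * (ph * μ * W) := by
    have : D.κ₁ / (b2 * ph * μ) * d2 = D.κ₁ * d2 / (b2 * ph * μ) := by ring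
    rw [this, div_lt_iff₀ (by positivity)] at hF'
    linarith
  have e5 : D.κ₁ * (d2 / (2 * b2)) < ph * μ * W / 2 := by
    -- The target margin: the other half of `κ₁ Q` together with `κ₂ Y` is at least `μ (V + Y) / 2 ≥
    -- ph μ W / 2`, which exceeds the loss `κ₁ d2 / (2 b2)` from Young's inequality.
    rw [mul_div_assoc', div_lt_div_iff₀ (by positivity) (by norm_num)]
    linarith
  have e6 : ph * W ≤ V + Y := by nlinarith
  have e7 : ph * μ * W ≤ μ * V + μ * Y := by nlinarith
  have e8 : μ * V ≤ 1 / 2 * D.κ₁ * b1 * V := by gcongr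
  have e9 : μ * Y ≤ D.κ₂ * Y := by gcongr
  have e10 : -P ≤ Q / 2 + d2 / (2 * b2) := by linarith
  have e11 : D.κ₁ * (-P) ≤ D.κ₁ * (Q / 2 + d2 / (2 * b2)) := by gcongr
  have e12 : D.κ₁ * (1 / 2 * b1 * V) ≤ D.κ₁ * Q := by gcongr
  have e13 : 0 ≤ D.κ₂ * Y := by positivity
  have e14 : 0 ≤ D.κ₁ * (1 / 2 * b1 * V) := by positivity
  linarith

/-- Along subsystems whose inequality constraints are active, the growth of the objective is
controlled by the violation of the equality constraints. -/
theorem exists_fderiv_f_h_le (hD : D.Admissible) (hβ : D.DampingBound β₁ β₂) :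
    ∃ C, 0 ≤ C ∧ ∀ A ∈ D.S, ∀ z ∈ D.Gineq, A ⊆ D.act z →
      fderiv ℝ D.f z (D.h A z) ≤ C * ∑ i, |D.geq z i| := by
  have hκ₁ := hD.κ₁_pos
  have hκ₂ := hD.κ₂_pos
  set c : Finset (Fin p) → ℝ := fun A => Real.sqrt (β₁ A * (D.dA A ⬝ᵥ D.dA A) / (2 * β₂ A))
  obtain ⟨M, hM⟩ := (D.S.image c).exists_le
  refine ⟨D.κ₁ * |M|, by positivity, fun A hA z hz hact => ?_⟩
  have hβ2 := (hβ A hA).2.1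
  have hβ1 := (hβ A hA).1
  obtain ⟨x, hx, hxw⟩ := hβ.exists_transpose_mulVec_eq hA hz (D.dA A)
  obtain ⟨y, hy, hyw⟩ := hβ.exists_transpose_mulVec_eq hA hz (D.gA A z)
  have q1 := hβ.quadratic_le hA hz y
  have q2 := hβ.le_quadratic hA hz x
  rw [hx] at q2
  rw [hy] at q1
  -- This splits the derivative into a damping term `-κ₁ y·g_A ≤ 0` and a cross term `κ₁ x·g_A`,
  -- with `x` bounded independently of the point.
  have hv : D.AA A z *ᵥ D.grad z = D.gA A z - D.dA A := by simp [gA]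
  rw [fderiv_f_h]
  have hg0 := dotProduct_self_nonneg_real (D.G A z *ᵥ D.grad z)
  rw [hv, sub_dotProduct, hxw, hyw]
  have h0 : 0 ≤ y ⬝ᵥ D.gA A z :=
    le_trans (mul_nonneg (by positivity) (dotProduct_self_nonneg_real _)) q1
  have hxi : ∀ i, |x i| ≤ |M| := fun i => by
    have h1 : x i ^ 2 ≤ x ⬝ᵥ x := by
      rw [sq]
      exact Finset.single_le_sum (f := fun i => x i * x i) (fun i _ => mul_self_nonneg _)
        (Finset.mem_univ i)
    have h2 : x ⬝ᵥ x ≤ β₁ A * (D.dA A ⬝ᵥ D.dA A) / (2 * β₂ A) := by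
      rw [le_div_iff₀ (by positivity)]
      linarith
    calc |x i| ≤ c A := Real.abs_le_sqrt (h1.trans h2)
      _ ≤ M := hM _ (Finset.mem_image_of_mem c hA)
      _ ≤ |M| := le_abs_self M
  have h1 : x ⬝ᵥ D.gA A z ≤ |M| * ∑ i, |D.geq z i| := by
    rw [gA_eq, dotProduct, Fintype.sum_sum_type]
    -- Only the equality rows of `g_A` survive, since the constraints in `A` vanish.
    have : ∀ i : {i // i ∈ A}, D.gineq z i.1 = 0 := fun i => by
      simpa [act] using hact i.2
    simp only [Sum.elim_inl, Sum.elim_inr, this, mul_zero, Finset.sum_const_zero, add_zero,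
      Finset.mul_sum]
    refine Finset.sum_le_sum fun i _ => ?_
    calc x (Sum.inl i) * D.geq z i ≤ |x (Sum.inl i)| * |D.geq z i| := by
          rw [← abs_mul]; exact le_abs_self _
      _ ≤ _ := mul_le_mul_of_nonneg_right (hxi _) (abs_nonneg _)
  have e1 := mul_le_mul_of_nonneg_left h1 hκ₁.le
  have e2 := mul_nonneg hκ₁.le h0
  have e3 := mul_nonneg hκ₂.le hg0
  linarith

end DampingBound

end OptData

/-! ### Local feasibility of the flow of one subsystem -/

namespace OptData

variable {n m p : ℕ} {D : OptData n m p} {A : Finset (Fin p)} {z : EuclideanSpace ℝ (Fin n)}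

theorem mem_act {i : Fin p} : i ∈ D.act z ↔ D.gineq z i = 0 := by
  simp [act]

theorem mem_S_of_subset_act (h : A ⊆ D.act z) : A ∈ D.S := by
  simp only [S, Finset.mem_filter, Finset.mem_univ, true_and]
  exact ⟨z, h⟩

/-- Strictness comes from continuity of the Jacobian and is what the quantitative open mapping
argument below requires. -/
theorem Admissible.hasStrictFDerivAt_gineq (hD : D.Admissible) (i : Fin p) :
    HasStrictFDerivAt (fun w => D.gineq w i) (fderiv ℝ (fun w => D.gineq w i) z) z := by
  refine hasStrictFDerivAt_of_hasFDerivAt_of_continuousAt (f' := fderiv ℝ fun w => D.gineq w i)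
    (Eventually.of_forall fun w => (hD.gineq_diff i w).hasFDerivAt) (Continuous.continuousAt ?_)
  refine continuous_clm_apply.2 fun v => ?_
  simp_rw [fderiv_apply_eq_sum _ v]
  exact continuous_finsetSum _ fun j _ => ((hD.Jineq_lip i j).continuous).mul continuous_const

/-- Local error bound: near a feasible point, the distance to the feasible set is bounded by the
violation of the constraints that are active at that point. -/
theorem DampingBound.exists_mem_Gineq_dist_le {β₁ β₂ : Finset (Fin p) → ℝ}
    (hβ : D.DampingBound β₁ β₂) (hD : D.Admissible) (hz : z ∈ D.Gineq) :
    ∃ C, 0 ≤ C ∧ ∀ s ∈ 𝓝 z, ∀ᶠ y in 𝓝 z, ∃ w ∈ D.Gineq, w ∈ s ∧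
      dist w y ≤ C * ‖fun i : {i // i ∈ D.act z} => max (D.gineq y i.1) 0‖ := by
  set A := D.act z with hAdef
  have hA : A ∈ D.S := mem_S_of_subset_act (z := z) (Finset.Subset.refl _)
  set F : EuclideanSpace ℝ (Fin n) → {i // i ∈ A} → ℝ := fun y i => D.gineq y i.1 with hF
  set F' : EuclideanSpace ℝ (Fin n) →L[ℝ] ({i // i ∈ A} → ℝ) :=
    ContinuousLinearMap.pi fun i => fderiv ℝ (fun w => D.gineq w i.1) z with hF'
  have hstrict : HasStrictFDerivAt F F' z :=
    hasStrictFDerivAt_pi.2 fun i => hD.hasStrictFDerivAt_gineq i.1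
  have hsurj : F'.range = ⊤ := by
    rw [LinearMap.range_eq_top]
    intro u
    have hu := (Matrix.isUnit_iff_isUnit_det _).1 (hβ.isUnit_B hA hz)
    -- As `B = J_A A_Aᵀ` is invertible, `A_Aᵀ B⁻¹` is a right inverse of the full Jacobian; the
    -- equality components are set to zero.
    refine ⟨WithLp.toLp 2 ((D.AA A z)ᵀ *ᵥ ((D.B A z)⁻¹ *ᵥ Sum.elim (0 : Fin m → ℝ) u)), ?_⟩
    have h1 : D.JA A z *ᵥ ((D.AA A z)ᵀ *ᵥ ((D.B A z)⁻¹ *ᵥ Sum.elim (0 : Fin m → ℝ) u))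
        = Sum.elim (0 : Fin m → ℝ) u := by
      rw [Matrix.mulVec_mulVec _ (D.JA A z), ← B, Matrix.mulVec_mulVec,
        Matrix.mul_nonsing_inv _ hu, Matrix.one_mulVec]
    funext i
    have h2 := congrFun h1 (Sum.inr i)
    rw [JA_mulVec] at h2
    change fderiv ℝ (fun w => D.gineq w i.1) z _ = u i
    rw [fderiv_apply_eq_sum]
    exact h2
  set R := F'.nonlinearRightInverseOfSurjective hsurj
  have hR : 0 < R.nnnorm := F'.nonlinearRightInverseOfSurjective_nnnorm_pos hsurj
  -- With half of the admissible error, the image of a ball of radius `2 R.nnnorm ρ` contains the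
  -- ball of radius `ρ`.
  obtain ⟨s', hs', happ⟩ := hstrict.approximates_deriv_on_nhds (c := R.nnnorm⁻¹ / 2)
    (Or.inr (by positivity))
  refine ⟨2 * R.nnnorm, by positivity, fun s hs => ?_⟩
  have hneg : ∀ᶠ w in 𝓝 z, ∀ j, j ∉ A → D.gineq w j < 0 := by
    rw [eventually_all]
    intro j
    by_cases hj : j ∈ A
    · exact Eventually.of_forall fun _ h => absurd hj h
    · have : D.gineq z j < 0 := lt_of_le_of_ne (hz j) fun h => hj (mem_act.2 h)
      filter_upwards [(hD.continuous_gineq j).continuousAt.eventually_lt_const this] with w hw _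
        using hw
  obtain ⟨r, hr, hball⟩ := Metric.mem_nhds_iff.1 (inter_mem (inter_mem hs hs') hneg)
  set pos : EuclideanSpace ℝ (Fin n) → {i // i ∈ A} → ℝ := fun y i => max (D.gineq y i.1) 0
  have hpos : Continuous fun y => 2 * (R.nnnorm : ℝ) * ‖pos y‖ :=
    continuous_const.mul (continuous_norm.comp
      (continuous_pi fun i => (hD.continuous_gineq i.1).max continuous_const))
  have hpos0 : pos z = 0 := by
    funext i
    simp [pos, mem_act.1 i.2]
  have hlt : ∀ᶠ y in 𝓝 z, 2 * (R.nnnorm : ℝ) * ‖pos y‖ < r / 2 :=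
    hpos.continuousAt.eventually_lt_const (by simpa [hpos0] using hr)
  filter_upwards [hlt, Metric.ball_mem_nhds z (half_pos hr)] with y hy1 hy2
  have hsub : Metric.closedBall y (2 * R.nnnorm * ‖pos y‖) ⊆ Metric.ball z r := by
    refine Metric.closedBall_subset_ball' ?_
    have := Metric.mem_ball.1 hy2
    linarith
  have hon := happ.surjOn_closedBall_of_nonlinearRightInverse R
    (ε := 2 * R.nnnorm * ‖pos y‖) (b := y) (by positivity)
    (hsub.trans (hball.trans fun w hw => hw.1.2))
  -- Truncating the constraint values at zero gives a feasible target at distance exactly `‖pos y‖`.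
  have htgt : (fun i : {i // i ∈ A} => min (D.gineq y i.1) 0) ∈ Metric.closedBall (F y)
      (((R.nnnorm : ℝ)⁻¹ - (R.nnnorm⁻¹ / 2 : NNReal)) * (2 * R.nnnorm * ‖pos y‖)) := by
    have he : ((R.nnnorm : ℝ)⁻¹ - (R.nnnorm⁻¹ / 2 : NNReal)) * (2 * R.nnnorm * ‖pos y‖)
        = ‖pos y‖ := by
      have : (R.nnnorm : ℝ) ≠ 0 := by positivity
      push_cast
      field_simp
      ring
    rw [he, Metric.mem_closedBall, dist_eq_norm, ← norm_neg]
    apply le_of_eq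
    congr 1
    funext i
    simp only [hF, pos, Pi.neg_apply, Pi.sub_apply]
    have := min_add_max (D.gineq y i.1) 0
    linarith
  obtain ⟨w, hw, hFw⟩ := hon htgt
  have hwU := hball (hsub hw)
  refine ⟨w, fun i => ?_, hwU.1.1, Metric.mem_closedBall.1 hw⟩
  by_cases hi : i ∈ A
  · have := congrFun hFw ⟨i, hi⟩
    change D.gineq w i = _ at this
    rw [this]
    exact min_le_right _ _
  · exact (hwU.2 i hi).le

/-- `y` follows subsystem `A` on `[t, t + ε)`. -/
def IsFlow (D : OptData n m p) (A : Finset (Fin p)) (t ε : ℝ)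
    (y : ℝ → EuclideanSpace ℝ (Fin n)) : Prop :=
  ∀ s ∈ Ico t (t + ε), HasDerivWithinAt y (D.h A (y s)) (Ico t (t + ε)) s

namespace IsFlow

variable {t ε : ℝ} {y : ℝ → EuclideanSpace ℝ (Fin n)}

theorem continuousOn (hy : D.IsFlow A t ε y) : ContinuousOn y (Ico t (t + ε)) :=
  fun s hs => (hy s hs).continuousWithinAt

theorem hasDerivWithinAt_Ici (hy : D.IsFlow A t ε y) {s : ℝ} (hs : s ∈ Ico t (t + ε)) :
    HasDerivWithinAt y (D.h A (y s)) (Ici s) s :=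
  (hy s hs).mono_of_mem_nhdsWithin <| mem_of_superset (Ico_mem_nhdsGE hs.2) fun _ hr =>
    ⟨hs.1.trans hr.1, hr.2⟩

theorem continuousWithinAt_Ici (hy : D.IsFlow A t ε y) (hε : 0 < ε) :
    ContinuousWithinAt y (Ici t) t :=
  (hy.hasDerivWithinAt_Ici ⟨le_rfl, by linarith⟩).continuousWithinAt

theorem mono {t' ε' : ℝ} (hy : D.IsFlow A t ε y) (h1 : t ≤ t') (h2 : t' + ε' ≤ t + ε) :
    D.IsFlow A t' ε' y := fun s hs =>
  (hy s ⟨h1.trans hs.1, hs.2.trans_le h2⟩).mono (Ico_subset_Ico h1 h2)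

theorem hasDerivWithinAt_gineq (hy : D.IsFlow A t ε y) (hD : D.Admissible) (i : Fin p) {s : ℝ}
    (hs : s ∈ Ico t (t + ε)) :
    HasDerivWithinAt (fun s => D.gineq (y s) i) (D.rate i A (y s)) (Ici s) s :=
  (hD.gineq_diff i (y s)).hasFDerivAt.comp_hasDerivWithinAt s (hy.hasDerivWithinAt_Ici hs)

theorem eventually_of_nhds (hy : D.IsFlow A t ε y) (hε : 0 < ε)
    {P : EuclideanSpace ℝ (Fin n) → Prop} (hP : ∀ᶠ w in 𝓝 (y t), P w) :
    ∀ᶠ s in 𝓝[≥] t, P (y s) :=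
  (hy.continuousWithinAt_Ici hε).eventually hP

end IsFlow

theorem exists_delta_of_eventually {t ε : ℝ} (hε : 0 < ε) {P : ℝ → Prop}
    (h : ∀ᶠ s in 𝓝[≥] t, P s) : ∃ δ, 0 < δ ∧ δ < ε ∧ ∀ s ∈ Icc t (t + δ), P s := by
  obtain ⟨u, hu, hsub⟩ := (mem_nhdsGE_iff_exists_Ico_subset).1 h
  refine ⟨min (ε / 2) ((u - t) / 2), lt_min (by linarith) ?_, ?_, fun s hs => hsub ⟨hs.1, ?_⟩⟩
  · have : t < u := hu
    linarith
  · exact (min_le_left _ _).trans_lt (by linarith)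
  · have : t < u := hu
    have := min_le_right (ε / 2) ((u - t) / 2)
    have := hs.2
    linarith

/-- Two trajectories of a subsystem that start from the same feasible point agree for a while. -/
theorem DampingBound.flow_unique {β₁ β₂ : Finset (Fin p) → ℝ} (hβ : D.DampingBound β₁ β₂)
    (hD : D.Admissible) (hA : A ∈ D.S) {t ε₁ ε₂ : ℝ} {y₁ y₂ : ℝ → EuclideanSpace ℝ (Fin n)}
    (h1 : D.IsFlow A t ε₁ y₁) (h2 : D.IsFlow A t ε₂ y₂) (hε₁ : 0 < ε₁) (hε₂ : 0 < ε₂)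
    (heq : y₁ t = y₂ t) (hz : y₁ t ∈ D.Gineq) : ∀ᶠ s in 𝓝[≥] t, y₁ s = y₂ s := by
  obtain ⟨K, U, hU, hK⟩ := hD.lipAt_h hA (hβ.isUnit_B hA hz)
  have e1 := h1.eventually_of_nhds hε₁ hU
  have e2 := h2.eventually_of_nhds hε₂ (heq ▸ hU)
  obtain ⟨δ, hδ, hδε, hs⟩ := exists_delta_of_eventually (lt_min hε₁ hε₂) (e1.and e2)
  have hδ1 := hδε.trans_le (min_le_left _ _)
  have hδ2 := hδε.trans_le (min_le_right _ _)
  have hE : EqOn y₁ y₂ (Icc t (t + δ)) := by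
    refine ODE_solution_unique_of_mem_Icc_right (v := fun _ => D.h A) (s := fun _ => U) (K := K)
      (fun _ _ => hK) (h1.continuousOn.mono fun s hs => ⟨hs.1, by linarith [hs.2]⟩)
      (fun s hs => h1.hasDerivWithinAt_Ici ⟨hs.1, by linarith [hs.2]⟩)
      (fun s hs' => (hs s ⟨hs'.1, hs'.2.le⟩).1)
      (h2.continuousOn.mono fun s hs => ⟨hs.1, by linarith [hs.2]⟩)
      (fun s hs => h2.hasDerivWithinAt_Ici ⟨hs.1, by linarith [hs.2]⟩)
      (fun s hs' => (hs s ⟨hs'.1, hs'.2.le⟩).2) heq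
  exact mem_of_superset (Icc_mem_nhdsGE (by linarith)) hE

theorem DampingBound.exists_flow {β₁ β₂ : Finset (Fin p) → ℝ} (hβ : D.DampingBound β₁ β₂)
    (hD : D.Admissible) (hA : A ∈ D.S) (hz : z ∈ D.Gineq) (t : ℝ) :
    ∃ ε y, 0 < ε ∧ y t = z ∧ D.IsFlow A t ε y := by
  have hL := hD.lipAt_h hA (hβ.isUnit_B hA hz)
  have hc := hL.continuousAt.norm.eventually_lt_const (lt_add_one ‖D.h A z‖)
  obtain ⟨K, U, hU, hK⟩ := hL
  obtain ⟨r, hr, hball⟩ := Metric.nhds_basis_closedBall.mem_iff.1 (inter_mem hU hc)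
  -- A speed bound near `z`; a curve this slow stays in the ball of radius `r` during time `r / L`.
  set L : NNReal := ⟨‖D.h A z‖ + 1, by positivity⟩
  have hL0 : (0 : ℝ) < L := by
    change 0 < ‖D.h A z‖ + 1
    positivity
  have hε : 0 < r / L := by positivity
  have hp : IsPicardLindelof (fun _ => D.h A) (tmin := t) (tmax := t + r / L)
      ⟨t, le_rfl, by linarith⟩ z ⟨r, hr.le⟩ 0 L K := by
    refine IsPicardLindelof.of_time_independent (fun x hx => ?_) (hK.mono fun x hx => ?_) ?_
    · exact le_of_lt (hball hx).2
    · exact (hball hx).1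
    · change (L : ℝ) * max (t + r / L - t) (t - t) ≤ r - 0
      rw [max_eq_left (by linarith), add_sub_cancel_left, mul_div_cancel₀ _ hL0.ne', sub_zero]
  obtain ⟨y, hy0, hy⟩ := hp.exists_eq_forall_mem_Icc_hasDerivWithinAt₀
  exact ⟨r / L, y, hε, hy0, fun s hs => (hy s ⟨hs.1, hs.2.le⟩).mono Ico_subset_Icc_self⟩

/-- Feasibility: if the constraints outside of the active set decrease right after `t`, then the
subsystem `A` stays feasible for a while, with exactly the constraints in `A` active. -/
theorem DampingBound.eventually_feasible {β₁ β₂ : Finset (Fin p) → ℝ} (hβ : D.DampingBound β₁ β₂)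
    (hD : D.Admissible) {t ε : ℝ} {y : ℝ → EuclideanSpace ℝ (Fin n)} (hy : D.IsFlow A t ε y)
    (hε : 0 < ε) (hz : y t ∈ D.Gineq) (hA : A ⊆ D.act (y t))
    (hr : ∀ i ∈ D.act (y t) \ A, ∀ᶠ s in 𝓝[>] t, D.rate i A (y s) < 0) :
    ∀ᶠ s in 𝓝[>] t, y s ∈ D.Gineq ∧ D.act (y s) = A := by
  have hAS : A ∈ D.S := mem_S_of_subset_act hA
  have hκ₁ := hD.κ₁_pos
  have hκ₂ := hD.κ₂_pos
  obtain ⟨K, V, hV, hK⟩ := hD.lipAt_residual (z := y t) hAS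
  obtain ⟨C, hC, herr⟩ := hβ.exists_mem_Gineq_dist_le hD hz
  have hneg : ∀ᶠ w in 𝓝 (y t), ∀ j, j ∉ D.act (y t) → D.gineq w j < 0 := by
    rw [eventually_all]
    intro j
    by_cases hj : j ∈ D.act (y t)
    · exact Eventually.of_forall fun _ h => absurd hj h
    · have : D.gineq (y t) j < 0 := lt_of_le_of_ne (hz j) fun h => hj (mem_act.2 h)
      filter_upwards [(hD.continuous_gineq j).continuousAt.eventually_lt_const this] with w hw _
        using hw
  have e1 := hy.eventually_of_nhds hε (((eventually_mem_set.2 hV).and (herr V hV)).and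
    (hneg.and (hD.eventually_isUnit_B (hβ.isUnit_B hAS hz))))
  have e2 : ∀ᶠ s in 𝓝[≥] t, s ≠ t → ∀ i ∈ D.act (y t) \ A, D.rate i A (y s) < 0 := by
    rw [← Ioi_insert, nhdsWithin_insert, eventually_sup]
    refine ⟨by simp, ?_⟩
    filter_upwards [(eventually_all_finset (D.act (y t) \ A)).2 hr] with s hs _ using hs
  obtain ⟨δ, hδ, hδε, hs⟩ := exists_delta_of_eventually hε (e1.and e2)
  have hI : Icc t (t + δ) ⊆ Ico t (t + ε) := fun s hs => ⟨hs.1, by linarith [hs.2]⟩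
  have hcont : ∀ i, ContinuousOn (fun s => D.gineq (y s) i) (Icc t (t + δ)) := fun i =>
    (hD.continuous_gineq i).comp_continuousOn (hy.continuousOn.mono hI)
  have hout : ∀ i ∈ D.act (y t) \ A, ∀ s ∈ Ioc t (t + δ), D.gineq (y s) i < 0 := by
    intro i hi s hs'
    have hanti : StrictAntiOn (fun s => D.gineq (y s) i) (Icc t (t + δ)) := by
      refine strictAntiOn_of_hasDerivWithinAt_neg (f' := fun s => D.rate i A (y s))
        (convex_Icc _ _) (hcont i) (fun s hs' => ?_) fun s hs' => ?_
      · rw [interior_Icc] at hs' ⊢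
        have h1 : HasDerivAt y (D.h A (y s)) s :=
          (hy s (hI (Ioo_subset_Icc_self hs'))).hasDerivAt
            (mem_of_superset (Icc_mem_nhds hs'.1 hs'.2) hI)
        exact ((hD.gineq_diff i (y s)).hasFDerivAt.comp_hasDerivAt s h1).hasDerivWithinAt
      · rw [interior_Icc] at hs'
        exact (hs s (Ioo_subset_Icc_self hs')).2 hs'.1.ne' i hi
    have := hanti ⟨le_rfl, by linarith⟩ (Ioc_subset_Icc_self hs') hs'.1
    simpa [mem_act.1 (Finset.mem_sdiff.1 hi).1] using this
  have hout' : ∀ i ∈ D.act (y t) \ A, ∀ s ∈ Icc t (t + δ), D.gineq (y s) i ≤ 0 := by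
    intro i hi s hs'
    rcases eq_or_lt_of_le hs'.1 with h | h
    · exact h ▸ hz i
    · exact (hout i hi s ⟨h, hs'.2⟩).le
  -- Grönwall's inequality for the vector of constraints in `A`, which starts at zero.
  have hzero : ∀ s ∈ Icc t (t + δ), (fun i : {i // i ∈ A} => D.gineq (y s) i.1) = 0 := by
    refine eq_zero_of_abs_deriv_le_mul_abs_self_of_eq_zero_right (K := D.κ₁ + D.κ₂ * (K * C))
      (f' := fun s i => D.rate i.1 A (y s)) (continuousOn_pi.2 fun i => hcont i.1)
      (fun s hs' => hasDerivWithinAt_pi.2 fun i =>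
        hy.hasDerivWithinAt_gineq hD i.1 (hI (Ico_subset_Icc_self hs'))) ?_ ?_
    · funext i
      exact mem_act.1 (hA i.2)
    · intro s hs'
      obtain ⟨⟨⟨hsV, w, hwG, hwV, hdist⟩, -, hu⟩, -⟩ := hs s (Ico_subset_Icc_self hs')
      set u : {i // i ∈ A} → ℝ := fun i => D.gineq (y s) i.1 with hudef
      -- Active constraints outside `A` are nonpositive along the flow, so only those in `A` can be
      -- violated.
      have hpos : ‖fun i : {i // i ∈ D.act (y t)} => max (D.gineq (y s) i.1) 0‖ ≤ ‖u‖ := by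
        refine (pi_norm_le_iff_of_nonneg (norm_nonneg _)).2 fun i => ?_
        by_cases hi : i.1 ∈ A
        · refine le_trans ?_ (norm_le_pi_norm u ⟨i.1, hi⟩)
          rw [Real.norm_eq_abs, Real.norm_eq_abs, abs_of_nonneg (le_max_right _ _)]
          exact max_le (le_abs_self _) (abs_nonneg _)
        · rw [max_eq_right (hout' i.1 (Finset.mem_sdiff.2 ⟨i.2, hi⟩) s (Ico_subset_Icc_self hs')),
            norm_zero]
          exact norm_nonneg _
      refine (pi_norm_le_iff_of_nonneg (by positivity)).2 fun i => ?_
      -- The residual vanishes at the nearby feasible point `w`; its Lipschitz constant and the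
      -- error bound turn this into a bound by `‖u‖`.
      have hres : |D.residual A (y s) i.1| ≤ K * C * ‖u‖ := by
        have h1 : |D.residual A (y s) i.1| ≤ dist (D.residual A (y s)) (D.residual A w) := by
          have := dist_le_pi_dist (D.residual A (y s)) (D.residual A w) i.1
          rwa [hD.residual_eq_zero hAS hwG i.2, Real.dist_eq, sub_zero] at this
        have h2 := hK.dist_le_mul (y s) hsV w hwV
        rw [dist_comm (y s)] at h2
        calc _ ≤ _ := h1.trans h2
          _ ≤ K * (C * ‖u‖) := by
            gcongr
            exact hdist.trans (by gcongr)
          _ = _ := by ring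
      rw [Real.norm_eq_abs, rate_of_mem hu i.2]
      have h3 : |D.gineq (y s) i.1| ≤ ‖u‖ := norm_le_pi_norm u i
      calc |-(D.κ₁ * D.gineq (y s) i.1) - D.κ₂ * D.residual A (y s) i.1|
          ≤ |-(D.κ₁ * D.gineq (y s) i.1)| + |D.κ₂ * D.residual A (y s) i.1| := abs_sub _ _
        _ = D.κ₁ * |D.gineq (y s) i.1| + D.κ₂ * |D.residual A (y s) i.1| := by
          rw [abs_neg, abs_mul, abs_mul, abs_of_pos hκ₁, abs_of_pos hκ₂]
        _ ≤ D.κ₁ * ‖u‖ + D.κ₂ * (K * C * ‖u‖) := by gcongr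
        _ = _ := by ring
  have hmem : Ioc t (t + δ) ∈ 𝓝[>] t := Ioc_mem_nhdsGT (by linarith)
  filter_upwards [hmem] with s hs'
  have hsI := Ioc_subset_Icc_self hs'
  have hin : ∀ i ∈ A, D.gineq (y s) i = 0 := fun i hi => congrFun (hzero s hsI) ⟨i, hi⟩
  have hnot : ∀ i, i ∉ A → D.gineq (y s) i < 0 := by
    intro i hi
    by_cases hact : i ∈ D.act (y t)
    · exact hout i (Finset.mem_sdiff.2 ⟨hact, hi⟩) s hs'
    · exact (hs s hsI).1.2.1 i hact
  refine ⟨fun i => ?_, ?_⟩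
  · by_cases hi : i ∈ A
    · exact (hin i hi).le
    · exact (hnot i hi).le
  · ext i
    rw [mem_act]
    exact ⟨fun h => by_contra fun hi => (hnot i hi).ne h, hin i⟩

end OptData

/-! ### The switching law: determinism, termination and persistence -/

namespace OptData

variable {n m p : ℕ} {D : OptData n m p} {A : Finset (Fin p)} {z : EuclideanSpace ℝ (Fin n)}
  {t : ℝ} {q q' q₁ q₂ : Finset (Fin p) × ℝ}

/-- Additions take precedence over removals, and only the smallest due index is removed. -/
theorem Update.right_unique (h₁ : D.Update t z q q₁) (h₂ : D.Update t z q q₂) : q₁ = q₂ := by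
  rcases h₁ with ⟨h₁, rfl⟩ | ⟨h₁, i, hi, hmin, rfl⟩ <;>
    rcases h₂ with ⟨h₂, rfl⟩ | ⟨h₂, j, hj, hmin', rfl⟩
  · rfl
  · simp [h₂] at h₁
  · simp [h₁] at h₂
  · rcases lt_trichotomy i j with h | rfl | h
    · exact absurd hi (hmin' i h)
    · rfl
    · exact absurd hj (hmin j h)

/-- Of two runs of a deterministic relation one extends the other, and both end at a mode that
admits no update. -/
theorem Switch.right_unique (h₁ : D.Switch t z q q₁) (h₂ : D.Switch t z q q₂) : q₁ = q₂ := by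
  have hu : Relator.RightUnique (D.Update t z) := fun _ _ _ a b => a.right_unique b
  rcases Relation.ReflTransGen.total_of_right_unique hu h₁.1 h₂.1 with h | h
  · rcases h.cases_head with rfl | ⟨c, hc, -⟩
    · rfl
    · exact absurd hc (h₁.2 c)
  · rcases h.cases_head with rfl | ⟨c, hc, -⟩
    · rfl
    · exact absurd hc (h₂.2 c)

theorem addNow_subset : D.addNow z A ⊆ D.act z := by
  intro i hi
  simp only [addNow, Finset.mem_filter, Finset.mem_sdiff] at hi
  exact hi.2.1.1

theorem addAfter_subset : D.addAfter t z A ⊆ D.act z \ A := by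
  intro i hi
  simp only [addAfter, Finset.mem_filter] at hi
  exact hi.2.1

theorem RemovalDue.le {i : Fin p} (h : D.RemovalDue t z q i) : q.2 + D.δT ≤ t := by
  obtain ⟨-, ε, y, -, -, -, hf⟩ := h
  by_contra! hlt
  obtain ⟨s, hs, hs'⟩ := (hf.and_eventually (Ioo_mem_nhdsGT hlt)).exists
  exact absurd hs.2 (not_lt.2 hs'.2.le)

theorem Update.subset_act (h : D.Update t z q q') (hq : q.1 ⊆ D.act z) : q'.1 ⊆ D.act z := by
  rcases h with ⟨-, rfl⟩ | ⟨-, i, -, -, rfl⟩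
  · exact Finset.union_subset hq (addAfter_subset.trans Finset.sdiff_subset)
  · exact (Finset.erase_subset _ _).trans hq

theorem Switch.subset_act (h : D.Switch t z q q') (hq : q.1 ⊆ D.act z) : q'.1 ⊆ D.act z := by
  refine Relation.ReflTransGen.head_induction_on
    (motive := fun q _ => q.1 ⊆ D.act z → q'.1 ⊆ D.act z) h.1 id
    (fun h1 _ ih hq => ih (h1.subset_act hq)) (Finset.union_subset hq addNow_subset)

/-- Either only additions were made, or a removal was due. -/
theorem Switch.cases (h : D.Switch t z q q') :
    (q'.2 = q.2 ∧ q.1 ⊆ q'.1) ∨ (q'.2 = t ∧ q.2 + D.δT ≤ t) := by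
  refine Relation.ReflTransGen.trans_induction_on
    (motive := fun {q q'} _ => (q'.2 = q.2 ∧ q.1 ⊆ q'.1) ∨ (q'.2 = t ∧ q.2 + D.δT ≤ t)) h.1
    (fun a => Or.inl ⟨rfl, Finset.Subset.refl _⟩) ?_ ?_ |>.imp_left
    fun h => ⟨h.1, Finset.subset_union_left.trans h.2⟩
  · rintro a b (⟨-, rfl⟩ | ⟨-, i, hi, -, rfl⟩)
    · exact Or.inl ⟨rfl, Finset.subset_union_left⟩
    · exact Or.inr ⟨rfl, hi.le⟩
  · rintro a b c - - (⟨h1, h2⟩ | ⟨h1, h2⟩) (⟨h3, h4⟩ | ⟨h3, h4⟩)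
    · exact Or.inl ⟨h3.trans h1, h2.trans h4⟩
    · exact Or.inr ⟨h3, h1 ▸ h4⟩
    · exact Or.inr ⟨h3.trans h1, h2⟩
    · exact Or.inr ⟨h3, h2⟩

/-- While the dwell time blocks removals, only additions are possible, and these shrink the
complement of the active set. -/
theorem Update.card_lt (h : D.Update t z q q') (hq : t < q.2 + D.δT) :
    q'.2 = q.2 ∧ (q'.1ᶜ).card < (q.1ᶜ).card := by
  rcases h with ⟨⟨i, hi⟩, rfl⟩ | ⟨-, i, hi, -, rfl⟩
  · refine ⟨rfl, Finset.card_lt_card (Finset.compl_ssubset_compl.2 ?_)⟩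
    refine (Finset.ssubset_iff_of_subset Finset.subset_union_left).2
      ⟨i, Finset.mem_union_right _ hi, (Finset.mem_sdiff.1 (addAfter_subset hi)).2⟩
  · exact absurd hi.le (not_le.2 hq)

theorem exists_terminal_of_lt : ∀ (k : ℕ) (q : Finset (Fin p) × ℝ), (q.1ᶜ).card = k →
    t < q.2 + D.δT → ∃ q', Relation.ReflTransGen (D.Update t z) q q' ∧
      ∀ q'', ¬ D.Update t z q' q'' := by
  intro k
  induction k using Nat.strong_induction_on with
  | _ k ih =>
    intro q hk hq
    by_cases h : ∃ q', D.Update t z q q'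
    · obtain ⟨q₁, h1⟩ := h
      obtain ⟨h2, h3⟩ := h1.card_lt hq
      obtain ⟨q', hq', hterm⟩ := ih _ (hk ▸ h3) q₁ rfl (h2 ▸ hq)
      exact ⟨q', Relation.ReflTransGen.head h1 hq', hterm⟩
    · exact ⟨q, .refl, not_exists.1 h⟩

/-- Additions decrease the measure. A first removal sets `Tₛ = t`, after which removals are blocked
and `exists_terminal_of_lt` applies. -/
theorem exists_terminal (hδ : 0 < D.δT) : ∀ (k : ℕ) (q : Finset (Fin p) × ℝ), (q.1ᶜ).card = k →
    ∃ q', Relation.ReflTransGen (D.Update t z) q q' ∧ ∀ q'', ¬ D.Update t z q' q'' := by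
  intro k
  induction k using Nat.strong_induction_on with
  | _ k ih =>
    intro q hk
    by_cases h : ∃ q', D.Update t z q q'
    · obtain ⟨q₁, h1⟩ := h
      obtain ⟨q', hq', hterm⟩ : ∃ q', Relation.ReflTransGen (D.Update t z) q₁ q' ∧
          ∀ q'', ¬ D.Update t z q' q'' := by
        rcases h1 with ⟨⟨i, hi⟩, rfl⟩ | ⟨-, i, -, -, rfl⟩
        · refine ih _ (hk ▸ Finset.card_lt_card (Finset.compl_ssubset_compl.2 ?_)) _ rfl
          exact (Finset.ssubset_iff_of_subset Finset.subset_union_left).2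
            ⟨i, Finset.mem_union_right _ hi, (Finset.mem_sdiff.1 (addAfter_subset hi)).2⟩
        · exact exists_terminal_of_lt _ _ rfl (by simpa using hδ)
      exact ⟨q', Relation.ReflTransGen.head h1 hq', hterm⟩
    · exact ⟨q, .refl, not_exists.1 h⟩

theorem exists_switch (hδ : 0 < D.δT) (t : ℝ) (z : EuclideanSpace ℝ (Fin n))
    (q : Finset (Fin p) × ℝ) : ∃ q', D.Switch t z q q' :=
  exists_terminal hδ _ _ rfl

theorem addAfter_eq_empty_of_terminal (h : ∀ q'', ¬ D.Update t z q q'') :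
    D.addAfter t z q.1 = ∅ := by
  by_contra hne
  exact h _ (Or.inl ⟨Finset.nonempty_iff_ne_empty.2 hne, rfl⟩)

theorem not_removalDue_of_terminal (h : ∀ q'', ¬ D.Update t z q q'') (i : Fin p) :
    ¬ D.RemovalDue t z q i := by
  intro hi
  obtain ⟨j, hj, hmin⟩ := WellFounded.has_min (wellFounded_lt (α := Fin p))
    {i | D.RemovalDue t z q i} ⟨i, hi⟩
  exact h _ (Or.inr ⟨addAfter_eq_empty_of_terminal h, j, hj, fun k hk hk' => hmin k hk' hk, rfl⟩)

namespace DampingBound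

variable {β₁ β₂ : Finset (Fin p) → ℝ} {ε : ℝ} {y : ℝ → EuclideanSpace ℝ (Fin n)}

/-- After the update loop has stopped, the flow of the current subsystem is feasible for a while,
with exactly the constraints of the current mode active. -/
theorem eventually_feasible_of_terminal (hβ : D.DampingBound β₁ β₂) (hD : D.Admissible)
    (hy : D.IsFlow q.1 t ε y) (hε : 0 < ε) (hz : y t ∈ D.Gineq) (hq : q.1 ⊆ D.act (y t))
    (h : ∀ q'', ¬ D.Update t (y t) q q'') :
    ∀ᶠ s in 𝓝[>] t, y s ∈ D.Gineq ∧ D.act (y s) = q.1 := by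
  refine hβ.eventually_feasible hD hy hε hz hq fun i hi => ?_
  by_contra hne
  -- If the rate is not eventually negative, it is nonnegative arbitrarily soon, so the addition
  -- would still be pending.
  have hadd : i ∈ D.addAfter t (y t) q.1 := by
    simp only [addAfter, Finset.mem_filter, Finset.mem_univ, true_and]
    refine ⟨hi, ε, y, hε, rfl, hy, fun hev => hne ?_⟩
    filter_upwards [hev] with s hs using not_le.1 hs
  simp [addAfter_eq_empty_of_terminal h] at hadd

/-- After the update loop has stopped, no further switching occurs for a while. -/
theorem eventually_switch_self (hβ : D.DampingBound β₁ β₂) (hD : D.Admissible)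
    (hy : D.IsFlow q.1 t ε y) (hε : 0 < ε) (hz : y t ∈ D.Gineq) (hq : q.1 ⊆ D.act (y t))
    (h : ∀ q'', ¬ D.Update t (y t) q q'') : ∀ᶠ s in 𝓝[>] t, D.Switch s (y s) q q := by
  have hfeas := hβ.eventually_feasible_of_terminal hD hy hε hz hq h
  have hrem : ∀ᶠ s in 𝓝[>] t, ∀ i ∈ q.1,
      ¬ (D.rate i (q.1.erase i) (y s) < 0 ∧ q.2 + D.δT < s) := by
    refine (eventually_all_finset q.1).2 fun i hi => ?_
    by_contra hne
    exact not_removalDue_of_terminal h i ⟨hi, ε, y, hε, rfl, hy, hne⟩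
  have hlt : ∀ᶠ s in 𝓝[>] t, s < t + ε := Iio_mem_nhds (by linarith) |> mem_nhdsWithin_of_mem_nhds
  obtain ⟨u, hu, hsub⟩ := mem_nhdsGT_iff_exists_Ioo_subset.1 (hfeas.and (hrem.and hlt))
  filter_upwards [Ioo_mem_nhdsGT hu] with s hs
  obtain ⟨⟨hsG, hact⟩, -, hsε⟩ := hsub hs
  have hnow : D.addNow (y s) q.1 = ∅ := by simp [addNow, hact]
  -- The active constraints are exactly those in the mode, so there are no candidates to add.
  have hafter : D.addAfter s (y s) q.1 = ∅ := by simp [addAfter, hact]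
  refine ⟨by rw [hnow, Finset.union_empty], ?_⟩
  rintro q'' (⟨h1, -⟩ | ⟨-, i, ⟨hi, ε', y', hε', hy0, hy', hfreq⟩, -, -⟩)
  · simp [hafter] at h1
  · have hA : q.1 ∈ D.S := mem_S_of_subset_act hq
    have hyr : D.IsFlow q.1 s (t + ε - s) y := hy.mono hs.1.le (by linarith)
    -- A removal due at `s` is witnessed by some flow from `y s`; by uniqueness that flow is `y`,
    -- for which `hrem` excludes removals at all times soon after `t`.
    have heq := hβ.flow_unique hD hA hyr hy' (by linarith) hε' hy0.symm hsG
    have heq' : ∀ᶠ r in 𝓝[>] s, y r = y' r := heq.filter_mono (nhdsWithin_mono _ Ioi_subset_Ici_self)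
    have hmem : ∀ᶠ r in 𝓝[>] s, r ∈ Ioo t u :=
      mem_of_superset (Ioo_mem_nhdsGT hs.2) fun r hr => ⟨hs.1.trans hr.1, hr.2⟩
    obtain ⟨r, hr, hr1, hr2⟩ := (hfreq.and_eventually (heq'.and hmem)).exists
    exact (hsub hr2).2.1 i hi (by rw [hr1]; exact hr)

end DampingBound

end OptData

/-! ### A priori properties of solutions -/

/-- Induction along a real interval. -/
theorem real_interval_induction {P : ℝ → Prop} {a b : ℝ} (h0 : P a)
    (left : ∀ t ∈ Ioc a b, (∀ s ∈ Ico a t, P s) → P t)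
    (right : ∀ t ∈ Ico a b, (∀ s ∈ Icc a t, P s) → ∀ᶠ s in 𝓝[>] t, P s) :
    ∀ t ∈ Icc a b, P t := by
  set S : Set ℝ := {t | ∀ s ∈ Icc a t, P s} with hS
  have hsub : Icc a b ⊆ S := by
    refine IsClosed.Icc_subset_of_forall_mem_nhdsWithin ?_ ?_ ?_
    · refine isClosed_of_closure_subset fun t ht => ?_
      have htI : t ∈ Icc a b :=
        closure_minimal inter_subset_right isClosed_Icc ht
      have hlt : ∀ s ∈ Ico a t, P s := by
        intro s hs
        obtain ⟨r, hr, hrS, -⟩ := mem_closure_iff.1 ht (Ioi s) isOpen_Ioi hs.2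
        exact hrS s ⟨hs.1, le_of_lt hr⟩
      refine ⟨fun s hs => ?_, htI⟩
      rcases eq_or_lt_of_le hs.2 with rfl | h
      · rcases eq_or_lt_of_le htI.1 with rfl | h'
        · exact h0
        · exact left s ⟨h', htI.2⟩ hlt
      · exact hlt s ⟨hs.1, h⟩
    · intro s hs
      rwa [le_antisymm hs.2 hs.1]
    · rintro t ⟨htS, ht⟩
      obtain ⟨u, hu, hsub⟩ := mem_nhdsGT_iff_exists_Ioo_subset.1 (right t ht htS)
      refine mem_of_superset (Ioo_mem_nhdsGT hu) fun r hr s hs => ?_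
      rcases le_or_gt s t with h | h
      · exact htS s ⟨hs.1, h⟩
      · exact hsub ⟨h, hs.2.trans_lt hr.2⟩
  exact fun t ht => hsub ht t ⟨ht.1, le_rfl⟩

namespace OptData

variable {n m p : ℕ} {D : OptData n m p} {A : Finset (Fin p)}
  {z : ℝ → EuclideanSpace ℝ (Fin n)} {q : ℝ → Finset (Fin p) × ℝ} {L : EReal}
  {β₁ β₂ : Finset (Fin p) → ℝ} {s t b : ℝ}

theorem horizon_mono (ht : t ∈ horizon L) (hs : 0 ≤ s) (hst : s ≤ t) : s ∈ horizon L :=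
  ⟨hs, (EReal.coe_le_coe_iff.2 hst).trans_lt ht.2⟩

theorem exists_gt_mem_horizon (ht : t ∈ horizon L) : ∃ b, t < b ∧ b ∈ horizon L := by
  obtain ⟨b, hb1, hb2⟩ := EReal.lt_iff_exists_real_btwn.1 ht.2
  exact ⟨b, EReal.coe_lt_coe_iff.1 hb1, ht.1.trans (EReal.coe_lt_coe_iff.1 hb1).le, hb2⟩

theorem mem_horizon_top (ht : 0 ≤ t) : t ∈ horizon ⊤ := ⟨ht, EReal.coe_lt_top t⟩

/-- A curve that satisfies the integral equation of a subsystem follows this subsystem. -/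
theorem DampingBound.exists_isFlow_of_integral_eq (hβ : D.DampingBound β₁ β₂) (hD : D.Admissible)
    (hA : A ∈ D.S) (htb : t < b) (hc : ContinuousOn z (Icc t b)) (hz : z t ∈ D.Gineq)
    (hint : ∀ s ∈ Icc t b, z s = z t + ∫ τ in t..s, D.h A (z τ)) :
    ∃ ε, 0 < ε ∧ t + ε ≤ b ∧ D.IsFlow A t ε z := by
  have hcw : ContinuousWithinAt z (Ici t) t :=
    (hc t ⟨le_rfl, htb.le⟩).mono_of_mem_nhdsWithin (Icc_mem_nhdsGE htb)
  obtain ⟨δ, hδ, hδb, hunit⟩ := exists_delta_of_eventually (sub_pos.2 htb)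
    (hcw.eventually (hD.eventually_isUnit_B (hβ.isUnit_B hA hz)))
  have hsub : Icc t (t + δ) ⊆ Icc t b := Icc_subset_Icc_right (by linarith)
  refine ⟨δ, hδ, by linarith, fun s hs => ?_⟩
  have hd := ODE.hasDerivWithinAt_picard_Icc (f := fun _ => D.h A) (u := {w | IsUnit (D.B A w)})
    (α := z) (t₀ := t) (tmin := t) (tmax := t + δ) ⟨le_rfl, by linarith⟩ ?_ (hc.mono hsub)
    hunit (z t) (Ico_subset_Icc_self hs)
  · refine (hd.congr (fun r hr => ?_) ?_).mono Ico_subset_Icc_self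
    · exact hint r (hsub hr)
    · exact hint s (hsub (Ico_subset_Icc_self hs))
  · intro x hx
    exact ((hD.lipAt_h hA hx.2).continuousAt.comp continuousAt_snd).continuousWithinAt

theorem isCompact_sublevel (hD : D.Admissible) (c : ℝ) : IsCompact (D.sublevel c) := by
  obtain ⟨K, hK, hsub⟩ := mem_cocompact.1 (hD.f_unbounded.eventually_gt_atTop c)
  refine hK.of_isClosed_subset (isClosed_le hD.f_diff.continuous continuous_const) fun w hw => ?_
  by_contra h
  have h1 : c < D.f w := hsub h
  exact absurd h1 (not_lt.2 hw)

theorem isCompact_Fset (hD : D.Admissible) (φ : Finset (Fin p) → ℝ) :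
    IsCompact (D.Fset β₁ β₂ φ) := by
  set c := D.κ₁ / (D.minS β₂ * D.minS φ * min (1 / 2 * D.κ₁ * D.minS β₁) D.κ₂)
      * ‖WithLp.toLp 2 (Sum.elim D.deq D.dineq)‖ ^ 2
  have ht : Tendsto (fun z => ‖gradient D.f z‖ ^ 2) (cocompact _) atTop :=
    (tendsto_pow_atTop two_ne_zero).comp hD.grad_unbounded
  obtain ⟨K, hK, hsub⟩ := mem_cocompact.1 (ht.eventually_gt_atTop c)
  have hc : Continuous fun z => ‖gradient D.f z‖ ^ 2 := hD.grad_lip.continuous.norm.pow 2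
  refine hK.of_isClosed_subset (isClosed_le hc continuous_const) fun w hw => ?_
  by_contra h
  have h1 : c < ‖gradient D.f w‖ ^ 2 := hsub h
  exact absurd h1 (not_lt.2 hw)

namespace IsSolution

theorem intervalIntegrable (h : D.IsSolution L z q) (ht : t ∈ horizon L) (hs : s ∈ horizon L) :
    IntervalIntegrable (fun τ => D.h (q τ).1 (z τ)) volume s t :=
  (h.integrable s hs).symm.trans (h.integrable t ht)

theorem eq_add_integral (h : D.IsSolution L z q) (hs : s ∈ horizon L) (ht : t ∈ horizon L) :
    z t = z s + ∫ τ in s..t, D.h (q τ).1 (z τ) := by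
  rw [h.integral_eq t ht, h.integral_eq s hs, add_assoc,
    intervalIntegral.integral_add_adjacent_intervals (h.integrable s hs)
      (h.intervalIntegrable ht hs)]

theorem continuousOn (h : D.IsSolution L z q) (hb : b ∈ horizon L) :
    ContinuousOn z (Icc 0 b) := by
  have hc := intervalIntegral.continuousOn_primitive_interval' (h.integrable b hb) left_mem_uIcc
  rw [uIcc_of_le hb.1] at hc
  exact (continuousOn_const.add hc).congr fun t ht => h.integral_eq t (horizon_mono hb ht.1 ht.2)

/-- Right after any time, a solution follows the subsystem that the switching law selects. -/
theorem exists_isFlow (h : D.IsSolution L z q) (hβ : D.DampingBound β₁ β₂) (hD : D.Admissible)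
    (ht : t ∈ horizon L) (hz : z t ∈ D.Gineq) (hq : (q t).1 ⊆ D.act (z t)) :
    ∃ q' ε, D.Switch t (z t) (q t) q' ∧ q'.1 ⊆ D.act (z t) ∧ 0 < ε ∧ D.IsFlow q'.1 t ε z ∧
      ∀ᶠ s in 𝓝[>] t, q s = q' := by
  obtain ⟨q', hsw, hev⟩ := h.switch t ht
  have hact := hsw.subset_act hq
  obtain ⟨b, htb, hb⟩ := exists_gt_mem_horizon ht
  obtain ⟨u, hu, hsub⟩ := mem_nhdsGT_iff_exists_Ioo_subset.1 hev
  set c := min b ((t + u) / 2)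
  have hu' : t < u := hu
  have htc : t < c := lt_min htb (by linarith)
  have hcu : c < u := (min_le_right _ _).trans_lt (by linarith)
  have hcb : c ≤ b := min_le_left _ _
  obtain ⟨ε, hε, -, hflow⟩ := hβ.exists_isFlow_of_integral_eq hD (mem_S_of_subset_act hact) htc
    ((h.continuousOn hb).mono (Icc_subset_Icc ht.1 hcb)) hz fun s hs => by
      rw [h.eq_add_integral ht (horizon_mono hb (ht.1.trans hs.1) (hs.2.trans hcb))]
      congr 1
      refine intervalIntegral.integral_congr_ae (Eventually.of_forall fun τ hτ => ?_)
      rw [uIoc_of_le hs.1] at hτ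
      have hq' : q τ = q' := hsub ⟨hτ.1, (hτ.2.trans hs.2).trans_lt hcu⟩
      simp only [hq']
  exact ⟨q', ε, hsw, hact, hε, hflow, hev⟩

/-- Solutions that start feasible stay feasible, and the constraints of the active set are
active. -/
theorem feasible (h : D.IsSolution L z q) (hβ : D.DampingBound β₁ β₂) (hD : D.Admissible)
    (h0 : z 0 ∈ D.Gineq) (hb : b ∈ horizon L) : z b ∈ D.Gineq ∧ (q b).1 ⊆ D.act (z b) := by
  refine real_interval_induction (P := fun t => z t ∈ D.Gineq ∧ (q t).1 ⊆ D.act (z t))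
    (a := 0) (b := b) ⟨h0, by rw [h.init]⟩ ?_ ?_ b ⟨hb.1, le_rfl⟩
  · intro t ht hlt
    have hth := horizon_mono hb ht.1.le ht.2
    have hc : ContinuousWithinAt z (Iio t) t :=
      ((h.continuousOn hth) t ⟨ht.1.le, le_rfl⟩).mono_of_mem_nhdsWithin
        (mem_of_superset (Ioo_mem_nhdsLT ht.1) Ioo_subset_Icc_self)
    have hmem : ∀ᶠ s in 𝓝[<] t, s ∈ Ico 0 t :=
      mem_of_superset (Ioo_mem_nhdsLT ht.1) Ioo_subset_Ico_self
    refine ⟨hD.isClosed_Gineq.mem_of_tendsto hc (hmem.mono fun s hs => (hlt s hs).1),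
      fun i hi => mem_act.2 ?_⟩
    have hci : Tendsto (fun s => D.gineq (z s) i) (𝓝[<] t) (𝓝 (D.gineq (z t) i)) :=
      (hD.continuous_gineq i).continuousAt.tendsto.comp hc
    -- Just before `t` the active set is already `q t`, so its constraints vanish there and also in
    -- the limit.
    refine tendsto_nhds_unique hci (tendsto_const_nhds.congr' ?_)
    filter_upwards [hmem, h.left_const t hth ht.1] with s hs hqs
    exact (mem_act.1 ((hlt s hs).2 (by rwa [hqs]))).symm
  · intro t ht hle
    have hth := horizon_mono hb ht.1 ht.2.le
    obtain ⟨hz, hq⟩ := hle t ⟨ht.1, le_rfl⟩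
    obtain ⟨q', ε, hsw, hact, hε, hflow, hev⟩ := h.exists_isFlow hβ hD hth hz hq
    filter_upwards [hβ.eventually_feasible_of_terminal hD hflow hε hz hact hsw.2, hev]
      with s hs hqs
    exact ⟨hs.1, by rw [hqs, hs.2]⟩

theorem exists_hasDerivWithinAt (h : D.IsSolution L z q) (hβ : D.DampingBound β₁ β₂)
    (hD : D.Admissible) (h0 : z 0 ∈ D.Gineq) (ht : t ∈ horizon L) :
    ∃ A ⊆ D.act (z t), HasDerivWithinAt z (D.h A (z t)) (Ici t) t := by
  obtain ⟨hz, hq⟩ := h.feasible hβ hD h0 ht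
  obtain ⟨q', ε, -, hact, hε, hflow, -⟩ := h.exists_isFlow hβ hD ht hz hq
  exact ⟨q'.1, hact, hflow.hasDerivWithinAt_Ici ⟨le_rfl, by linarith⟩⟩

/-- The right derivatives of a solution and of the objective along it. -/
theorem exists_modes (h : D.IsSolution L z q) (hβ : D.DampingBound β₁ β₂)
    (hD : D.Admissible) (h0 : z 0 ∈ D.Gineq) :
    ∃ M : ℝ → Finset (Fin p), ∀ t ∈ horizon L, M t ⊆ D.act (z t) ∧ z t ∈ D.Gineq ∧
      HasDerivWithinAt z (D.h (M t) (z t)) (Ici t) t ∧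
      HasDerivWithinAt (fun t => D.f (z t)) (fderiv ℝ D.f (z t) (D.h (M t) (z t))) (Ici t) t := by
  have hM : ∀ t, ∃ A, t ∈ horizon L → A ⊆ D.act (z t) ∧
      HasDerivWithinAt z (D.h A (z t)) (Ici t) t := fun t => by
    by_cases ht : t ∈ horizon L
    · obtain ⟨A, hA, hd⟩ := h.exists_hasDerivWithinAt hβ hD h0 ht
      exact ⟨A, fun _ => ⟨hA, hd⟩⟩
    · exact ⟨∅, fun h => absurd h ht⟩
  choose M hM using hM
  exact ⟨M, fun t ht => ⟨(hM t ht).1, (h.feasible hβ hD h0 ht).1, (hM t ht).2,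
    (hD.f_diff (z t)).hasFDerivAt.comp_hasDerivWithinAt t (hM t ht).2⟩⟩

/-- The product of `exp (κ₁ t)` with an equality constraint has zero right derivative, whichever
subsystem is active. -/
theorem geq_eq (h : D.IsSolution L z q) (hβ : D.DampingBound β₁ β₂) (hD : D.Admissible)
    (h0 : z 0 ∈ D.Gineq) (ht : t ∈ horizon L) (i : Fin m) :
    D.geq (z t) i = Real.exp (-(D.κ₁ * t)) * D.geq (z 0) i := by
  obtain ⟨M, hM⟩ := h.exists_modes hβ hD h0
  have hcz : ContinuousOn (fun t => D.geq (z t) i) (Icc 0 t) :=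
    (hD.geq_diff i).continuous.comp_continuousOn (h.continuousOn ht)
  have hconst := constant_of_has_deriv_right_zero (a := 0) (b := t)
    (f := fun t => Real.exp (D.κ₁ * t) * D.geq (z t) i)
    ((Continuous.continuousOn (by fun_prop)).mul hcz) (fun r hr => ?_) t ⟨ht.1, le_rfl⟩
  · simp only [mul_zero, Real.exp_zero, one_mul] at hconst
    rw [← hconst, ← mul_assoc, ← Real.exp_add, neg_add_cancel, Real.exp_zero, one_mul]
  · have hrh := horizon_mono ht hr.1 hr.2.le
    obtain ⟨hact, hz, hd, -⟩ := hM r hrh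
    have hA := mem_S_of_subset_act hact
    have h1 : HasDerivWithinAt (fun t => D.geq (z t) i) (-(D.κ₁ * D.geq (z r) i)) (Ici r) r := by
      rw [← hD.fderiv_geq_h hA hz (hβ.isUnit_B hA hz) i]
      exact (hD.geq_diff i (z r)).hasFDerivAt.comp_hasDerivWithinAt r hd
    have h2 : HasDerivWithinAt (fun t => Real.exp (D.κ₁ * t)) (Real.exp (D.κ₁ * r) * D.κ₁)
        (Ici r) r := by
      simpa using (((hasDerivAt_id r).const_mul D.κ₁).exp).hasDerivWithinAt
    exact (h2.mul h1).congr_deriv (by ring)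

end IsSolution

/-! ### Invariant sublevel sets and boundedness -/

/-- Every sublevel set that contains `F` is positively invariant. -/
theorem positivelyInvariant_sublevel (hD : D.Admissible) (hβ : D.DampingBound β₁ β₂)
    {φ : Finset (Fin p) → ℝ} (hφ : D.StackBound φ) {c : ℝ}
    (hc : D.Fset β₁ β₂ φ ⊆ D.sublevel c) : D.PositivelyInvariant (D.sublevel c) := by
  intro L z q h h0 s hs t ht hst hzs
  obtain ⟨M, hM⟩ := h.exists_modes hβ hD h0
  change D.f (z t) ≤ c
  -- The slack `δ` puts every point on the barrier outside `F`, where the decrease is strict.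
  refine le_of_forall_pos_le_add fun δ hδ => ?_
  refine image_le_of_deriv_right_lt_deriv_boundary' (f := fun t => D.f (z t)) (a := s) (b := t)
    (f' := fun t => fderiv ℝ D.f (z t) (D.h (M t) (z t))) (B := fun _ => c + δ) (B' := fun _ => 0)
    (hD.f_diff.continuous.comp_continuousOn
      ((h.continuousOn ht).mono (Icc_subset_Icc_left hs.1)))
    (fun r hr => (hM r (horizon_mono ht (hs.1.trans hr.1) hr.2.le)).2.2.2) ?_ continuousOn_const
    (fun r _ => hasDerivWithinAt_const _ _ _) ?_ ⟨hst, le_rfl⟩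
  · have : D.f (z s) ≤ c := hzs
    linarith
  · intro r hr hfr
    obtain ⟨hact, hz, -, -⟩ := hM r (horizon_mono ht (hs.1.trans hr.1) hr.2.le)
    refine DampingBound.fderiv_f_h_neg hD hβ hφ (mem_S_of_subset_act hact) hz fun hF => ?_
    have : D.f (z r) ≤ c := hc hF
    linarith

/-- The level is the maximum of `f` on the compact set `F ∪ {z₀}`. -/
theorem exists_isSmallestSublevel (hD : D.Admissible) {φ : Finset (Fin p) → ℝ}
    (z₀ : EuclideanSpace ℝ (Fin n)) :
    ∃ c, D.IsSmallestSublevel (D.sublevel c) (D.Fset β₁ β₂ φ ∪ {z₀}) := by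
  obtain ⟨w, hw, hmax⟩ := ((isCompact_Fset hD φ (β₁ := β₁) (β₂ := β₂)).union
    isCompact_singleton).exists_isMaxOn ⟨z₀, Or.inr rfl⟩ hD.f_diff.continuous.continuousOn
  refine ⟨D.f w, ⟨_, rfl⟩, fun x hx => hmax hx, fun c hc x hx => ?_⟩
  have h1 : D.f x ≤ D.f w := hx
  have h2 : D.f w ≤ c := hc hw
  exact h1.trans h2

/-- All solutions from a feasible initial point stay in a common compact set of feasible points. -/
theorem DampingBound.exists_isCompact (hβ : D.DampingBound β₁ β₂) (hD : D.Admissible)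
    {z₀ : EuclideanSpace ℝ (Fin n)} (hz₀ : z₀ ∈ D.Gineq) :
    ∃ K, IsCompact K ∧ K ⊆ D.Gineq ∧ ∀ (L : EReal) (z : ℝ → EuclideanSpace ℝ (Fin n))
      (q : ℝ → Finset (Fin p) × ℝ), D.IsSolution L z q → z 0 = z₀ → ∀ t ∈ horizon L, z t ∈ K := by
  obtain ⟨C, hC, hle⟩ := DampingBound.exists_fderiv_f_h_le hD hβ
  have hκ := hD.κ₁_pos
  set Γ := ∑ i, |D.geq z₀ i|
  have hΓ : 0 ≤ Γ := Finset.sum_nonneg fun _ _ => abs_nonneg _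
  refine ⟨D.sublevel (D.f z₀ + C * Γ / D.κ₁) ∩ D.Gineq,
    (isCompact_sublevel hD _).inter_right hD.isClosed_Gineq, inter_subset_right, ?_⟩
  intro L z q h h0 t ht
  have h0' : z 0 ∈ D.Gineq := h0 ▸ hz₀
  refine ⟨?_, (h.feasible hβ hD h0' ht).1⟩
  obtain ⟨M, hM⟩ := h.exists_modes hβ hD h0'
  -- The comparison function is `f z₀` plus the integral of `C Γ exp (-κ₁ τ)` over `[0, t]`; it
  -- never exceeds `f z₀ + C Γ / κ₁`.
  have hB := image_le_of_deriv_right_le_deriv_boundary (f := fun t => D.f (z t)) (a := 0) (b := t)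
    (f' := fun t => fderiv ℝ D.f (z t) (D.h (M t) (z t)))
    (B := fun t => D.f z₀ + C * Γ / D.κ₁ * (1 - Real.exp (-(D.κ₁ * t))))
    (B' := fun t => C * (Real.exp (-(D.κ₁ * t)) * Γ))
    (hD.f_diff.continuous.comp_continuousOn (h.continuousOn ht))
    (fun r hr => (hM r (horizon_mono ht hr.1 hr.2.le)).2.2.2) (by simp [h0])
    (Continuous.continuousOn (by fun_prop)) (fun r hr => ?_) (fun r hr => ?_)
    (x := t) ⟨ht.1, le_rfl⟩
  · have he := Real.exp_pos (-(D.κ₁ * t))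
    have hK : 0 ≤ C * Γ / D.κ₁ := by positivity
    change D.f (z t) ≤ _
    nlinarith
  · have h1 : HasDerivAt (fun t => Real.exp (-(D.κ₁ * t))) (Real.exp (-(D.κ₁ * r)) * -D.κ₁) r := by
      simpa using (((hasDerivAt_id r).const_mul D.κ₁).neg).exp
    have h2 := ((h1.const_sub 1).const_mul (C * Γ / D.κ₁)).const_add (D.f z₀)
    refine HasDerivAt.hasDerivWithinAt ?_
    convert h2 using 1
    field_simp
  · have hrh := horizon_mono ht hr.1 hr.2.le
    obtain ⟨hact, hz, -, -⟩ := hM r hrh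
    refine (hle _ (mem_S_of_subset_act hact) _ hz hact).trans_eq ?_
    simp only [h.geq_eq hβ hD h0' hrh, abs_mul, Real.abs_exp, ← Finset.mul_sum, h0, Γ]

end OptData

/-! ### Uniqueness of solutions and finiteness of switching -/

namespace OptData

variable {n m p : ℕ} {D : OptData n m p} {A : Finset (Fin p)}
  {z z' : ℝ → EuclideanSpace ℝ (Fin n)} {q q' : ℝ → Finset (Fin p) × ℝ} {L L' : EReal}
  {β₁ β₂ : Finset (Fin p) → ℝ} {s t b R : ℝ}

theorem continuousOn_h (hβ : D.DampingBound β₁ β₂) (hD : D.Admissible) (hA : A ∈ D.S) :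
    ContinuousOn (D.h A) D.Gineq := fun _ hw =>
  (hD.lipAt_h hA (hβ.isUnit_B hA hw)).continuousAt.continuousWithinAt

namespace IsSolution

theorem restrict (h : D.IsSolution L z q) (hL : L' ≤ L) : D.IsSolution L' z q where
  init := h.init
  integrable t ht := h.integrable t ⟨ht.1, ht.2.trans_le hL⟩
  integral_eq t ht := h.integral_eq t ⟨ht.1, ht.2.trans_le hL⟩
  left_const t ht := h.left_const t ⟨ht.1, ht.2.trans_le hL⟩
  switch t ht := h.switch t ⟨ht.1, ht.2.trans_le hL⟩

/-- A curve that locally agrees with solutions is a solution. -/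
theorem of_local (hinit : (q 0).1 = D.act (z 0))
    (h : ∀ t ∈ horizon L, ∃ b : ℝ, t < b ∧ ∃ z' q', D.IsSolution b z' q' ∧
      ∀ s ∈ Ico 0 b, z s = z' s ∧ q s = q' s) : D.IsSolution L z q where
  init := hinit
  integrable t ht := by
    obtain ⟨b, htb, z', q', h', heq⟩ := h t ht
    refine (h'.integrable t ⟨ht.1, EReal.coe_lt_coe_iff.2 htb⟩).congr fun τ hτ => ?_
    rw [uIoc_of_le ht.1] at hτ
    obtain ⟨h1, h2⟩ := heq τ ⟨hτ.1.le, hτ.2.trans_lt htb⟩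
    simp only [h1, h2]
  integral_eq t ht := by
    obtain ⟨b, htb, z', q', h', heq⟩ := h t ht
    rw [(heq t ⟨ht.1, htb⟩).1, (heq 0 ⟨le_rfl, ht.1.trans_lt htb⟩).1,
      h'.integral_eq t ⟨ht.1, EReal.coe_lt_coe_iff.2 htb⟩]
    congr 1
    refine intervalIntegral.integral_congr fun τ hτ => ?_
    rw [uIcc_of_le ht.1] at hτ
    obtain ⟨h1, h2⟩ := heq τ ⟨hτ.1, hτ.2.trans_lt htb⟩
    simp only [h1, h2]
  left_const t ht h0 := by
    obtain ⟨b, htb, z', q', h', heq⟩ := h t ht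
    filter_upwards [h'.left_const t ⟨ht.1, EReal.coe_lt_coe_iff.2 htb⟩ h0, Ioo_mem_nhdsLT h0]
      with s hs hs'
    rw [(heq s ⟨hs'.1.le, hs'.2.trans htb⟩).2, hs, (heq t ⟨ht.1, htb⟩).2]
  switch t ht := by
    obtain ⟨b, htb, z', q', h', heq⟩ := h t ht
    obtain ⟨q₁, hsw, hev⟩ := h'.switch t ⟨ht.1, EReal.coe_lt_coe_iff.2 htb⟩
    refine ⟨q₁, ?_, ?_⟩
    · rwa [(heq t ⟨ht.1, htb⟩).1, (heq t ⟨ht.1, htb⟩).2]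
    · filter_upwards [hev, Ioo_mem_nhdsGT htb] with s hs hs'
      rw [(heq s ⟨ht.1.trans hs'.1.le, hs'.2⟩).2, hs]

/-- Solutions are determined by their initial values. -/
theorem unique (h : D.IsSolution L z q) (h' : D.IsSolution L' z' q') (hβ : D.DampingBound β₁ β₂)
    (hD : D.Admissible) (h0 : z 0 ∈ D.Gineq) (hz : z 0 = z' 0) (hT : (q 0).2 = (q' 0).2)
    (hb : b ∈ horizon L) (hb' : b ∈ horizon L') : z b = z' b ∧ q b = q' b := by
  have h0' : z' 0 ∈ D.Gineq := hz ▸ h0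
  refine real_interval_induction (P := fun t => z t = z' t ∧ q t = q' t) (a := 0) (b := b)
    ⟨hz, Prod.ext (by rw [h.init, h'.init, hz]) hT⟩ ?_ ?_ b ⟨hb.1, le_rfl⟩
  · intro t ht hlt
    have hth := horizon_mono hb ht.1.le ht.2
    have hth' := horizon_mono hb' ht.1.le ht.2
    have hI : Icc 0 t ∈ 𝓝[<] t := mem_of_superset (Ioo_mem_nhdsLT ht.1) Ioo_subset_Icc_self
    have hmem : ∀ᶠ s in 𝓝[<] t, s ∈ Ico 0 t :=
      mem_of_superset (Ioo_mem_nhdsLT ht.1) Ioo_subset_Ico_self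
    have hc : ContinuousWithinAt z (Iio t) t :=
      ((h.continuousOn hth) t ⟨ht.1.le, le_rfl⟩).mono_of_mem_nhdsWithin hI
    have hc' : ContinuousWithinAt z' (Iio t) t :=
      ((h'.continuousOn hth') t ⟨ht.1.le, le_rfl⟩).mono_of_mem_nhdsWithin hI
    refine ⟨tendsto_nhds_unique hc (hc'.congr' (hmem.mono fun s hs => (hlt s hs).1.symm)), ?_⟩
    obtain ⟨s, h1, h2, h3⟩ := (hmem.and
      ((h.left_const t hth ht.1).and (h'.left_const t hth' ht.1))).exists
    rw [← h2, ← h3, (hlt s h1).2]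
  · intro t ht hle
    have hth := horizon_mono hb ht.1 ht.2.le
    have hth' := horizon_mono hb' ht.1 ht.2.le
    obtain ⟨e1, e2⟩ := hle t ⟨ht.1, le_rfl⟩
    obtain ⟨hG, hact⟩ := h.feasible hβ hD h0 hth
    obtain ⟨hG', hact'⟩ := h'.feasible hβ hD h0' hth'
    obtain ⟨q₁, ε₁, hsw₁, hact₁, hε₁, hfl₁, hev₁⟩ := h.exists_isFlow hβ hD hth hG hact
    obtain ⟨q₂, ε₂, hsw₂, -, hε₂, hfl₂, hev₂⟩ := h'.exists_isFlow hβ hD hth' hG' hact'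
    rw [← e1, ← e2] at hsw₂
    -- Equal states and modes at `t` select the same next mode, after which both solutions follow
    -- one subsystem.
    obtain rfl := hsw₁.right_unique hsw₂
    have hu := hβ.flow_unique hD (mem_S_of_subset_act hact₁) hfl₁ hfl₂ hε₁ hε₂ e1 hG
    filter_upwards [hu.filter_mono (nhdsWithin_mono _ Ioi_subset_Ici_self), hev₁, hev₂]
      with s hs1 hs2 hs3
    exact ⟨hs1, hs2.trans hs3.symm⟩

/-- Induction on the switching times. -/
theorem mode_induction (h : D.IsSolution L z q) {P : Finset (Fin p) × ℝ → Prop} {a : ℝ}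
    (ha : 0 ≤ a) (hab : a ≤ b) (hb : b ∈ horizon L) (hP : P (q a))
    (step : ∀ t ∈ Ico a b, ∀ q', P (q t) → D.Switch t (z t) (q t) q' →
      (∃ s ∈ Ioo t b, q s = q') → P q') : P (q b) := by
  refine real_interval_induction (P := fun t => P (q t)) (a := a) (b := b) hP ?_ ?_ b
    ⟨hab, le_rfl⟩
  · intro t ht hlt
    have h0 : 0 < t := ha.trans_lt ht.1
    obtain ⟨s, hs, hs'⟩ := ((h.left_const t (horizon_mono hb h0.le ht.2) h0).and
      (Ioo_mem_nhdsLT ht.1)).exists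
    rw [← hs]
    exact hlt s ⟨hs'.1.le, hs'.2⟩
  · intro t ht hle
    obtain ⟨q₁, hsw, hev⟩ := h.switch t (horizon_mono hb (ha.trans ht.1) ht.2.le)
    obtain ⟨s, hs, hs'⟩ := (hev.and (Ioo_mem_nhdsGT ht.2)).exists
    have := step t ht q₁ (hle t ⟨ht.1, le_rfl⟩) hsw ⟨s, hs', hs⟩
    filter_upwards [hev] with r hr
    rwa [hr]

/-- By the dwell time, the mode is constant on some interval `[c, R)`. -/
theorem exists_left_const (h : D.IsSolution (R : EReal) z q) (hδ : 0 < D.δT) (hR : 0 < R) :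
    ∃ c ∈ Ico 0 R, ∀ t ∈ Ico c R, q t = q c := by
  have hmem : ∀ t, t ∈ Ico 0 R → t ∈ horizon (R : EReal) := fun t ht =>
    ⟨ht.1, EReal.coe_lt_coe_iff.2 ht.2⟩
  obtain ⟨b, hb, hmono⟩ : ∃ b ∈ Ico 0 R, ∀ s t, b ≤ s → s ≤ t → t < R →
      (q t).2 = (q s).2 ∧ (q s).1 ⊆ (q t).1 := by
    -- Either the dwell condition blocks all removals from some `b` up to `R`, or `Tₛ + δT < R`
    -- throughout; in the latter case a removal at `r ≥ R - δT` would set `Tₛ = r` and contradict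
    -- this bound.
    by_cases hex : ∃ b ∈ Ico 0 R, R ≤ (q b).2 + D.δT
    · obtain ⟨b, hb, hbR⟩ := hex
      have hconst : ∀ t, b ≤ t → t < R → (q t).2 = (q b).2 := fun t hbt htR =>
        h.mode_induction (P := fun m => m.2 = (q b).2) hb.1 hbt (hmem t ⟨hb.1.trans hbt, htR⟩) rfl
          fun r hr q' hq hsw _ => by
            rcases hsw.cases with ⟨h1, -⟩ | ⟨-, h2⟩
            · exact h1.trans hq
            · rw [hq] at h2
              linarith [hr.2]
      refine ⟨b, hb, fun s t hbs hst htR => ⟨?_, ?_⟩⟩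
      · rw [hconst t (hbs.trans hst) htR, hconst s hbs (hst.trans_lt htR)]
      · refine h.mode_induction (P := fun m => (q s).1 ⊆ m.1) (hb.1.trans hbs) hst
          (hmem t ⟨hb.1.trans (hbs.trans hst), htR⟩) (Finset.Subset.refl _)
          fun r hr q' hq hsw _ => ?_
        rcases hsw.cases with ⟨-, h1⟩ | ⟨-, h2⟩
        · exact hq.trans h1
        · rw [hconst r (hbs.trans hr.1) (hr.2.trans htR)] at h2
          linarith [hr.2]
    · push Not at hex
      refine ⟨max 0 (R - D.δT), ⟨le_max_left _ _, max_lt hR (by linarith)⟩,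
        fun s t hbs hst htR => ?_⟩
      have hs0 : 0 ≤ s := (le_max_left _ _).trans hbs
      refine h.mode_induction (P := fun m => m.2 = (q s).2 ∧ (q s).1 ⊆ m.1) hs0 hst
        (hmem t ⟨hs0.trans hst, htR⟩) ⟨rfl, Finset.Subset.refl _⟩ ?_
      rintro r hr q' hq hsw ⟨r', hr', rfl⟩
      rcases hsw.cases with ⟨h1, h2⟩ | ⟨h1, -⟩
      · exact ⟨h1.trans hq.1, hq.2.trans h2⟩
      · have h2 := hex r' ⟨(hs0.trans hr.1).trans hr'.1.le, hr'.2.trans htR⟩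
        have h3 := (le_max_right 0 (R - D.δT)).trans (hbs.trans hr.1)
        linarith
  -- Without removals the active set is monotone on `[b, R)`, hence constant once it has reached a
  -- maximal value.
  obtain ⟨σ, ⟨c, hc, rfl⟩, hmax⟩ := WellFounded.has_min (wellFounded_gt (α := Finset (Fin p)))
    ((fun t => (q t).1) '' Ico b R) ⟨_, b, ⟨le_rfl, hb.2⟩, rfl⟩
  refine ⟨c, ⟨hb.1.trans hc.1, hc.2⟩, fun t ht => ?_⟩
  obtain ⟨h1, h2⟩ := hmono c t hc.1 ht.1 ht.2
  refine Prod.ext (Finset.Subset.antisymm ?_ h2) h1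
  by_contra hne
  exact hmax _ ⟨t, ⟨hc.1.trans ht.1, ht.2⟩, rfl⟩ (lt_of_le_not_ge h2 hne)

end IsSolution

/-- Solutions from a given feasible initial point are uniformly Lipschitz. -/
theorem DampingBound.exists_lipschitz (hβ : D.DampingBound β₁ β₂) (hD : D.Admissible)
    {z₀ : EuclideanSpace ℝ (Fin n)} (hz₀ : z₀ ∈ D.Gineq) :
    ∃ M : NNReal, ∀ (L : EReal) (z : ℝ → EuclideanSpace ℝ (Fin n))
      (q : ℝ → Finset (Fin p) × ℝ), D.IsSolution L z q → z 0 = z₀ →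
      LipschitzOnWith M z (horizon L) := by
  obtain ⟨K, hK, hKG, hsol⟩ := hβ.exists_isCompact hD hz₀
  have hC : ∀ A, ∃ C, A ∈ D.S → ∀ w ∈ K, ‖D.h A w‖ ≤ C := fun A => by
    by_cases hA : A ∈ D.S
    · obtain ⟨C, hC⟩ := hK.exists_bound_of_continuousOn ((continuousOn_h hβ hD hA).mono hKG)
      exact ⟨C, fun _ => hC⟩
    · exact ⟨0, fun h => absurd h hA⟩
  choose C hC using hC
  refine ⟨∑ A ∈ D.S, ‖C A‖₊, fun L z q h h0 => ?_⟩
  refine LipschitzOnWith.of_dist_le_mul fun s hs t ht => ?_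
  rw [dist_comm (z s), dist_comm s, dist_eq_norm, h.eq_add_integral hs ht, add_sub_cancel_left,
    Real.dist_eq]
  refine intervalIntegral.norm_integral_le_of_norm_le_const fun τ hτ => ?_
  have hτh : τ ∈ horizon L := by
    rw [uIoc] at hτ
    exact horizon_mono (t := max s t) (by rcases max_choice s t with h | h <;> rwa [h])
      ((le_min hs.1 ht.1).trans hτ.1.le) hτ.2
  have hA := mem_S_of_subset_act (h.feasible hβ hD (h0 ▸ hz₀) hτh).2
  refine (hC _ hA _ (hsol L z q h h0 τ hτh)).trans ((le_abs_self _).trans ?_)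
  rw [NNReal.coe_sum]
  exact Finset.single_le_sum (f := fun A => ((‖C A‖₊ : NNReal) : ℝ)) (fun _ _ => NNReal.coe_nonneg _)
    hA

/-! ### Continuation, gluing and global existence -/

/-- A solution that is also defined at the end point of its interval can be continued. -/
theorem IsSolution.exists_continuation (h : D.IsSolution (R : EReal) z q)
    (hβ : D.DampingBound β₁ β₂) (hD : D.Admissible) (hR : 0 ≤ R)
    (hint : IntervalIntegrable (fun τ => D.h (q τ).1 (z τ)) volume 0 R)
    (hzR : z R = z 0 + ∫ τ in (0 : ℝ)..R, D.h (q τ).1 (z τ))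
    (hleft : 0 < R → ∀ᶠ s in 𝓝[<] R, q s = q R) (hG : z R ∈ D.Gineq)
    (hact : (q R).1 ⊆ D.act (z R)) :
    ∃ b : ℝ, R < b ∧ ∃ z' q', D.IsSolution (b : EReal) z' q' ∧ z' 0 = z 0 ∧ q' 0 = q 0 := by
  obtain ⟨q₁, hsw⟩ := D.exists_switch hD.δT_pos R (z R) (q R)
  have hact₁ := hsw.subset_act hact
  have hA := mem_S_of_subset_act hact₁
  obtain ⟨ε, y, hε, hy0, hy⟩ := hβ.exists_flow hD hA hG R
  rw [← hy0] at hG hact₁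
  have hterm : ∀ q'', ¬ D.Update R (y R) q₁ q'' := by rw [hy0]; exact hsw.2
  have hlt : ∀ᶠ s in 𝓝[>] R, s < R + ε :=
    mem_nhdsWithin_of_mem_nhds (Iio_mem_nhds (by linarith))
  obtain ⟨b, hb, hsub⟩ := mem_nhdsGT_iff_exists_Ioo_subset.1
    ((hβ.eventually_feasible_of_terminal hD hy hε hG hact₁ hterm).and
      ((hβ.eventually_switch_self hD hy hε hG hact₁ hterm).and hlt))
  have hRb : R < b := hb
  have hyG : ∀ s ∈ Ico R b, y s ∈ D.Gineq := fun s hs => by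
    rcases eq_or_lt_of_le hs.1 with rfl | h'
    · exact hG
    · exact (hsub ⟨h', hs.2⟩).1.1
  have hlt' : ∀ t, t < b → ∀ s ∈ Icc R t, s ∈ Ico R (R + ε) := fun t htb s hs => by
    rcases eq_or_lt_of_le hs.1 with rfl | h'
    · exact ⟨le_rfl, by linarith⟩
    · exact ⟨hs.1, (hsub ⟨h', hs.2.trans_lt htb⟩).2.2⟩
  have hcy : ∀ t, t < b → ContinuousOn (fun τ => D.h q₁.1 (y τ)) (Icc R t) := fun t htb =>
    (continuousOn_h hβ hD hA).comp (hy.continuousOn.mono (hlt' t htb))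
      fun s hs => hyG s ⟨hs.1, hs.2.trans_lt htb⟩
  set z' : ℝ → EuclideanSpace ℝ (Fin n) := fun t => if t ≤ R then z t else y t with hz'
  -- At `R` itself the old mode is kept, as left-continuity demands; the new mode holds strictly
  -- after `R`.
  set q' : ℝ → Finset (Fin p) × ℝ := fun t => if t ≤ R then q t else q₁ with hq'
  have zle : ∀ t, t ≤ R → z' t = z t := fun t ht => if_pos ht
  have qle : ∀ t, t ≤ R → q' t = q t := fun t ht => if_pos ht
  have zgt : ∀ t, R < t → z' t = y t := fun t ht => if_neg (not_le.2 ht)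
  have qgt : ∀ t, R < t → q' t = q₁ := fun t ht => if_neg (not_le.2 ht)
  have hbefore : ∀ t, 0 ≤ t → t ≤ R →
      IntervalIntegrable (fun τ => D.h (q' τ).1 (z' τ)) volume 0 t ∧
      z' t = z' 0 + ∫ τ in (0 : ℝ)..t, D.h (q' τ).1 (z' τ) := by
    intro t h0 ht
    have heq : ∀ τ ∈ uIcc 0 t, D.h (q' τ).1 (z' τ) = D.h (q τ).1 (z τ) := fun τ hτ => by
      rw [uIcc_of_le h0] at hτ
      rw [zle τ (hτ.2.trans ht), qle τ (hτ.2.trans ht)]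
    rw [intervalIntegral.integral_congr heq, zle t ht, zle 0 hR]
    refine ⟨IntervalIntegrable.congr (f := fun τ => D.h (q τ).1 (z τ))
      (fun τ hτ => (heq τ (uIoc_subset_uIcc hτ)).symm) ?_, ?_⟩
    · rcases eq_or_lt_of_le ht with rfl | h'
      · exact hint
      · exact h.integrable t ⟨h0, EReal.coe_lt_coe_iff.2 h'⟩
    · rcases eq_or_lt_of_le ht with rfl | h'
      · exact hzR
      · exact h.integral_eq t ⟨h0, EReal.coe_lt_coe_iff.2 h'⟩
  have hafter : ∀ t, R < t → t < b →
      IntervalIntegrable (fun τ => D.h (q' τ).1 (z' τ)) volume R t ∧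
      z' t = z' R + ∫ τ in R..t, D.h (q' τ).1 (z' τ) := by
    intro t hRt htb
    have heq : ∀ τ ∈ uIoc R t, D.h q₁.1 (y τ) = D.h (q' τ).1 (z' τ) := fun τ hτ => by
      rw [uIoc_of_le hRt.le] at hτ
      rw [zgt τ hτ.1, qgt τ hτ.1]
    have hi : IntervalIntegrable (fun τ => D.h q₁.1 (y τ)) volume R t :=
      ContinuousOn.intervalIntegrable (by rw [uIcc_of_le hRt.le]; exact hcy t htb)
    refine ⟨hi.congr heq, ?_⟩
    rw [← intervalIntegral.integral_congr_ae (Eventually.of_forall heq), zgt t hRt, zle R le_rfl,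
      ← hy0, intervalIntegral.integral_eq_sub_of_hasDeriv_right _ _ hi, add_sub_cancel]
    · rw [uIcc_of_le hRt.le]
      exact hy.continuousOn.mono (hlt' t htb)
    · rw [min_eq_left hRt.le, max_eq_right hRt.le]
      exact fun s hs => (hy.hasDerivWithinAt_Ici (hlt' t htb s (Ioo_subset_Icc_self hs))).mono
        Ioi_subset_Ici_self
  refine ⟨b, hRb, z', q', ⟨?_, ?_, ?_, ?_, ?_⟩, zle 0 hR, qle 0 hR⟩
  · rw [zle 0 hR, qle 0 hR, h.init]
  · intro t ht
    rcases le_or_gt t R with h' | h'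
    · exact (hbefore t ht.1 h').1
    · exact (hbefore R hR le_rfl).1.trans (hafter t h' (EReal.coe_lt_coe_iff.1 ht.2)).1
  · intro t ht
    rcases le_or_gt t R with h' | h'
    · exact (hbefore t ht.1 h').2
    · obtain ⟨i1, e1⟩ := hbefore R hR le_rfl
      obtain ⟨i2, e2⟩ := hafter t h' (EReal.coe_lt_coe_iff.1 ht.2)
      rw [e2, e1, add_assoc, intervalIntegral.integral_add_adjacent_intervals i1 i2]
  · intro t ht h0
    rcases lt_trichotomy t R with h' | rfl | h'
    · filter_upwards [h.left_const t ⟨ht.1, EReal.coe_lt_coe_iff.2 h'⟩ h0, self_mem_nhdsWithin]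
        with s hs hs'
      rw [qle t h'.le, qle s ((le_of_lt hs').trans h'.le), hs]
    · filter_upwards [hleft h0, self_mem_nhdsWithin] with s hs hs'
      rw [qle t le_rfl, qle s (le_of_lt hs'), hs]
    · filter_upwards [Ioo_mem_nhdsLT h'] with s hs
      rw [qgt t h', qgt s hs.1]
  · intro t ht
    have htb := EReal.coe_lt_coe_iff.1 ht.2
    rcases lt_trichotomy t R with h' | rfl | h'
    · obtain ⟨q₂, hsw₂, hev⟩ := h.switch t ⟨ht.1, EReal.coe_lt_coe_iff.2 h'⟩
      rw [zle t h'.le, qle t h'.le]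
      refine ⟨q₂, hsw₂, ?_⟩
      filter_upwards [hev, Ioo_mem_nhdsGT h'] with s hs hs'
      rw [qle s hs'.2.le, hs]
    · rw [zle t le_rfl, qle t le_rfl]
      refine ⟨q₁, hsw, ?_⟩
      filter_upwards [self_mem_nhdsWithin] with s hs
      exact qgt s hs
    · rw [zgt t h', qgt t h']
      refine ⟨q₁, (hsub ⟨h', htb⟩).2.1, ?_⟩
      filter_upwards [self_mem_nhdsWithin] with s hs
      exact qgt s (h'.trans hs)

/-- Solutions on bounded intervals can be continued. -/
theorem IsSolution.exists_extension (h : D.IsSolution (R : EReal) z q)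
    (hβ : D.DampingBound β₁ β₂) (hD : D.Admissible) (hR : 0 ≤ R) (h0 : z 0 ∈ D.Gineq) :
    ∃ b : ℝ, R < b ∧ ∃ z' q', D.IsSolution (b : EReal) z' q' ∧ z' 0 = z 0 ∧ q' 0 = q 0 := by
  rcases eq_or_lt_of_le hR with rfl | hR0
  · exact h.exists_continuation hβ hD le_rfl IntervalIntegrable.refl (by simp)
      (fun h => absurd h (lt_irrefl _)) h0 (by rw [h.init])
  obtain ⟨c, hc, hconst⟩ := h.exists_left_const hD.δT_pos hR0
  have hmem : ∀ t, t ∈ Ico 0 R → t ∈ horizon (R : EReal) := fun t ht =>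
    ⟨ht.1, EReal.coe_lt_coe_iff.2 ht.2⟩
  have hcR : Ico c R ⊆ horizon (R : EReal) := fun t ht => hmem t ⟨hc.1.trans ht.1, ht.2⟩
  have hch : c ∈ horizon (R : EReal) := hmem c hc
  obtain ⟨M, hM⟩ := hβ.exists_lipschitz hD h0
  -- The Lipschitz extension supplies the limit of the solution at `R` as the value `g R`.
  obtain ⟨g, hg, hgz⟩ := ((hM _ z q h rfl).mono hcR).extend_finite_dimension
  have hgc := hg.continuous
  have hcl : Icc c R ⊆ closure (Ico c R) := by rw [closure_Ico hc.2.ne]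
  have hgG : ∀ t ∈ Icc c R, g t ∈ D.Gineq := fun t ht => by
    refine hD.isClosed_Gineq.closure_subset
      (map_mem_closure (s := Ico c R) hgc (hcl ht) fun s hs => ?_)
    rw [← hgz hs]
    exact (h.feasible hβ hD h0 (hcR hs)).1
  set A := (q c).1 with hAdef
  have hAact : A ⊆ D.act (z c) := (h.feasible hβ hD h0 hch).2
  have hA := mem_S_of_subset_act hAact
  have hgA : A ⊆ D.act (g R) := fun i hi => by
    have he : EqOn (fun t => D.gineq (g t) i) (fun _ => 0) (Icc c R) := by
      refine EqOn.of_subset_closure (s := Ico c R) (fun t ht => ?_)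
        ((hD.continuous_gineq i).comp hgc).continuousOn continuousOn_const Ico_subset_Icc_self hcl
      have := (h.feasible hβ hD h0 (hcR ht)).2
      rw [hconst t ht] at this
      change D.gineq (g t) i = 0
      rw [← hgz ht]
      exact mem_act.1 (this hi)
    exact mem_act.2 (he ⟨hc.2.le, le_rfl⟩)
  have hhc : ContinuousOn (fun τ => D.h A (g τ)) (Icc c R) :=
    (continuousOn_h hβ hD hA).comp hgc.continuousOn hgG
  have hhi : IntervalIntegrable (fun τ => D.h A (g τ)) volume c R :=
    ContinuousOn.intervalIntegrable (by rwa [uIcc_of_le hc.2.le])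
  have hgint : g R = z c + ∫ τ in c..R, D.h A (g τ) := by
    have hprim : ContinuousOn (fun t => z c + ∫ τ in c..t, D.h A (g τ)) (Icc c R) := by
      have := intervalIntegral.continuousOn_primitive_interval' hhi left_mem_uIcc
      rw [uIcc_of_le hc.2.le] at this
      exact continuousOn_const.add this
    refine EqOn.of_subset_closure (s := Ico c R) (fun t ht => ?_) hgc.continuousOn hprim
      Ico_subset_Icc_self hcl ⟨hc.2.le, le_rfl⟩
    rw [← hgz ht, h.eq_add_integral hch (hcR ht)]
    congr 1
    refine intervalIntegral.integral_congr fun τ hτ => ?_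
    rw [uIcc_of_le ht.1] at hτ
    have hτ' : τ ∈ Ico c R := ⟨hτ.1, hτ.2.trans_lt ht.2⟩
    simp only [hconst τ hτ', hgz hτ', hAdef]
  -- A solution on `[0, R)` may have arbitrary values at `R`, so these are replaced by the limits.
  set z₁ := Function.update z R (g R)
  set q₁ := Function.update q R (q c)
  have zne : ∀ t, t < R → z₁ t = z t := fun t ht => Function.update_of_ne ht.ne _ _
  have qne : ∀ t, t < R → q₁ t = q t := fun t ht => Function.update_of_ne ht.ne _ _
  have zR : z₁ R = g R := Function.update_self _ _ _
  have qR : q₁ R = q c := Function.update_self _ _ _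
  have hsol : D.IsSolution (R : EReal) z₁ q₁ :=
    IsSolution.of_local (by rw [zne 0 hR0, qne 0 hR0, h.init]) fun t ht =>
      ⟨R, EReal.coe_lt_coe_iff.1 ht.2, z, q, h, fun s hs => ⟨zne s hs.2, qne s hs.2⟩⟩
  have heq : ∀ τ ∈ uIcc c R, D.h A (g τ) = D.h (q₁ τ).1 (z₁ τ) := fun τ hτ => by
    rw [uIcc_of_le hc.2.le] at hτ
    rcases eq_or_lt_of_le hτ.2 with rfl | h'
    · rw [zR, qR]
    · rw [zne τ h', qne τ h', hconst τ ⟨hτ.1, h'⟩, hgz ⟨hτ.1, h'⟩]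
  have hi2 : IntervalIntegrable (fun τ => D.h (q₁ τ).1 (z₁ τ)) volume c R :=
    hhi.congr fun τ hτ => heq τ (uIoc_subset_uIcc hτ)
  have hi1 := hsol.integrable c hch
  have hres := hsol.exists_continuation hβ hD hR (hi1.trans hi2) ?_ ?_ (by
    rw [zR]; exact hgG R ⟨hc.2.le, le_rfl⟩) (by rw [zR, qR]; exact hgA)
  · rwa [zne 0 hR0, qne 0 hR0] at hres
  · rw [zR, hgint, ← intervalIntegral.integral_add_adjacent_intervals hi1 hi2, ← add_assoc,
      ← hsol.integral_eq c hch, zne c hc.2, intervalIntegral.integral_congr heq]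
  · intro _
    filter_upwards [Ioo_mem_nhdsLT hc.2] with s hs
    rw [qR, qne s hs.2, hconst s ⟨hs.1.le, hs.2⟩]

/-- Solutions on growing bounded intervals can be glued. -/
theorem DampingBound.exists_glued (hβ : D.DampingBound β₁ β₂) (hD : D.Admissible)
    {z₀ : EuclideanSpace ℝ (Fin n)} (hz₀ : z₀ ∈ D.Gineq) (T₀ : ℝ)
    (h : ∀ t ∈ horizon L, ∃ b : ℝ, t < b ∧ ∃ z q, D.IsSolution (b : EReal) z q ∧ z 0 = z₀ ∧
      q 0 = (D.act z₀, T₀)) :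
    ∃ z q, D.IsSolution L z q ∧ z 0 = z₀ ∧ q 0 = (D.act z₀, T₀) := by
  have h' : ∀ t, ∃ Z : ℝ → EuclideanSpace ℝ (Fin n), ∃ Q : ℝ → Finset (Fin p) × ℝ, ∃ b : ℝ,
      Z 0 = z₀ ∧ Q 0 = (D.act z₀, T₀) ∧ (t ∈ horizon L → t < b ∧ D.IsSolution (b : EReal) Z Q) := by
    intro t
    by_cases ht : t ∈ horizon L
    · obtain ⟨b, hb, Z, Q, hs, h1, h2⟩ := h t ht
      exact ⟨Z, Q, b, h1, h2, fun _ => ⟨hb, hs⟩⟩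
    · exact ⟨fun _ => z₀, fun _ => (D.act z₀, T₀), 0, rfl, rfl, fun h => absurd h ht⟩
  choose Z Q b hZ hQ hs using h'
  -- The diagonal choice is consistent, because by uniqueness solutions chosen for different times
  -- agree where both are defined.
  refine ⟨fun t => Z t t, fun t => Q t t, IsSolution.of_local ?_ fun t ht => ?_, hZ 0, hQ 0⟩
  · simp only [hZ, hQ]
  · obtain ⟨c, htc, hc⟩ := exists_gt_mem_horizon ht
    refine ⟨c, htc, Z c, Q c, (hs c hc).2.restrict (EReal.coe_le_coe_iff.2 (hs c hc).1.le),
      fun s hsI => ?_⟩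
    have hsh := horizon_mono hc hsI.1 hsI.2.le
    exact (hs s hsh).2.unique (hs c hc).2 hβ hD (by rwa [hZ]) (by rw [hZ, hZ]) (by rw [hQ, hQ])
      ⟨hsI.1, EReal.coe_lt_coe_iff.2 (hs s hsh).1⟩
      ⟨hsI.1, EReal.coe_lt_coe_iff.2 (hsI.2.trans (hs c hc).1)⟩

/-- Global existence. -/
theorem DampingBound.exists_solution (hβ : D.DampingBound β₁ β₂) (hD : D.Admissible)
    {z₀ : EuclideanSpace ℝ (Fin n)} (hz₀ : z₀ ∈ D.Gineq) (T₀ : ℝ) :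
    ∃ z q, D.IsSolution ⊤ z q ∧ z 0 = z₀ ∧ q 0 = (D.act z₀, T₀) := by
  set I : Set ℝ := {b | 0 ≤ b ∧ ∃ z q, D.IsSolution (b : EReal) z q ∧ z 0 = z₀ ∧
    q 0 = (D.act z₀, T₀)} with hI
  have h0 : (0 : ℝ) ∈ I := by
    -- For `b = 0` the horizon is empty, and all conditions except the initial one are vacuous.
    refine ⟨le_rfl, fun _ => z₀, fun _ => (D.act z₀, T₀), ⟨rfl, ?_, ?_, ?_, ?_⟩, rfl, rfl⟩ <;>
      exact fun t ht => absurd (EReal.coe_lt_coe_iff.1 ht.2) (not_lt.2 ht.1)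
  have hglue : ∀ {L : EReal}, (∀ t ∈ horizon L, ∃ b ∈ I, t < b) →
      ∃ z q, D.IsSolution L z q ∧ z 0 = z₀ ∧ q 0 = (D.act z₀, T₀) := fun hL =>
    hβ.exists_glued hD hz₀ T₀ fun t ht => by
      obtain ⟨b, hb, htb⟩ := hL t ht
      exact ⟨b, htb, hb.2⟩
  by_cases hbdd : BddAbove I
  · exfalso
    -- Gluing gives a solution up to the supremum, and its extension past that point contradicts the
    -- supremum.
    obtain ⟨z, q, hs, hz, hq⟩ := hglue (L := (sSup I : ℝ)) fun t ht =>
      exists_lt_of_lt_csSup ⟨0, h0⟩ (EReal.coe_lt_coe_iff.1 ht.2)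
    have hR : 0 ≤ sSup I := le_csSup hbdd h0
    obtain ⟨b, hb, z', q', hs', hz', hq'⟩ := hs.exists_extension hβ hD hR (by rwa [hz])
    exact absurd (le_csSup hbdd ⟨hR.trans hb.le, z', q', hs', hz'.trans hz, hq'.trans hq⟩)
      (not_le.2 hb)
  · exact hglue fun t _ => not_bddAbove_iff.1 hbdd t

end OptData

theorem proposition3 {n m p : ℕ} (D : OptData n m p) (hD : D.Admissible)
    (β₁ β₂ : Finset (Fin p) → ℝ) (hβ : D.DampingBound β₁ β₂) :
    (∀ φ : Finset (Fin p) → ℝ, D.StackBound φ →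
      (∀ c : ℝ, D.Fset β₁ β₂ φ ⊆ D.sublevel c → D.PositivelyInvariant (D.sublevel c)) ∧
      (∀ z₀ ∈ D.Gineq, ∃ F₀ : Set (EuclideanSpace ℝ (Fin n)),
        D.IsSmallestSublevel F₀ (D.Fset β₁ β₂ φ ∪ {z₀}) ∧ D.PositivelyInvariant F₀)) ∧
    (∀ z₀ ∈ D.Gineq, ∀ T₀ : ℝ,
      ∃ (z : ℝ → EuclideanSpace ℝ (Fin n)) (q : ℝ → Finset (Fin p) × ℝ),
        D.IsSolution ⊤ z q ∧ z 0 = z₀ ∧ (q 0).2 = T₀ ∧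
        (∀ t, 0 ≤ t → (q t).1 ∈ D.S) ∧
        (∀ t, 0 ≤ t → AbsolutelyContinuousOnInterval z 0 t) ∧
        Bornology.IsBounded (z '' Ici 0) ∧
        ∀ (L : EReal) (z' : ℝ → EuclideanSpace ℝ (Fin n)) (q' : ℝ → Finset (Fin p) × ℝ),
          D.IsSolution L z' q' → z' 0 = z₀ → (q' 0).2 = T₀ →
          ∀ t ∈ OptData.horizon L, z' t = z t ∧ q' t = q t) := by
  refine ⟨fun φ hφ => ⟨fun c hc => OptData.positivelyInvariant_sublevel hD hβ hφ hc,
    fun z₀ _ => ?_⟩, fun z₀ hz₀ T₀ => ?_⟩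
  · obtain ⟨c, hc⟩ := OptData.exists_isSmallestSublevel hD (β₁ := β₁) (β₂ := β₂) (φ := φ) z₀
    exact ⟨_, hc, OptData.positivelyInvariant_sublevel hD hβ hφ (subset_union_left.trans hc.2.1)⟩
  · obtain ⟨z, q, hs, hz, hq⟩ := hβ.exists_solution hD hz₀ T₀
    have hz0 : z 0 ∈ D.Gineq := by rwa [hz]
    obtain ⟨K, hK, -, hsol⟩ := hβ.exists_isCompact hD hz₀
    obtain ⟨M, hM⟩ := hβ.exists_lipschitz hD hz₀
    refine ⟨z, q, hs, hz, by rw [hq], fun t ht => ?_, fun t ht => ?_, ?_, ?_⟩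
    · exact OptData.mem_S_of_subset_act
        (hs.feasible hβ hD hz0 (OptData.mem_horizon_top ht)).2
    · refine ((hM _ z q hs hz).mono fun s hs' => ?_).absolutelyContinuousOnInterval
      rw [uIcc_of_le ht] at hs'
      exact OptData.mem_horizon_top hs'.1
    · refine hK.isBounded.subset ?_
      rintro _ ⟨t, ht, rfl⟩
      exact hsol _ z q hs hz t (OptData.mem_horizon_top ht)
    · intro L z' q' hs' hz' hT' t ht
      exact hs'.unique hs hβ hD (by rwa [hz']) (hz'.trans hz.symm) (by rw [hT', hq]) ht
        (OptData.mem_horizon_top ht.1)
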